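/- Let $q$ be a power of a prime $p$, let $\Phi^+$ be the set of positive roots of type $\mathrm E_6$, with simple roots $\alpha_1,\dots,\alpha_6$ (Bourbaki labelling), and let $U=\mathrm{UE}_6(q)$ be the subgroup generated by the root elements $x_\alpha(t)$, $\alpha\in\Phi^+$, $t\in\mathbb F_q$, of the Chevalley group of type $\mathrm E_6$ over $\mathbb F_q$; put $X_\alpha=\{x_\alpha(t)\mid t\in\mathbb F_q\}$. Write $c_1c_2c_3c_4c_5c_6$ for $\sum_i c_i\alpha_i$, and let $\alpha_7=101000$, $\alpha_9=001100$, $\alpha_{10}=000110$, $\alpha_{11}=000011$, $\alpha_{12}=101100$, $\alpha_{13}=011100$, $\alpha_{14}=010110$, $\alpha_{16}=000111$, $\alpha_{18}=101110$, $\alpha_{19}=011110$, $\alpha_{22}=111110$, $\alpha_{24}=011210$, $\alpha_{25}=011111$; write $x_i=x_{\alpha_i}$, $X_i=X_{\alpha_i}$. Let $$\mathcal S=\{\alpha_i\mid i\in\{1,4,6,7,9,10,11,12,13,14,16,18,19,22,24,25\}\},\qquad \mathcal Z=\{\alpha_i\mid i\in\{12,16,18,22,24,25\}\}$$ (the unique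 nonabelian $[6,16,12]$-core of $\mathrm{UE}_6(q)$: $|\mathcal Z|=6$, $|\mathcal S|=16$, and $\mathcal S$ contains $12$ relations $\alpha+\beta=\gamma$). A set $\mathcal P\subseteq\Phi^+$ is a pattern if $\alpha,\beta\in\mathcal P$ and $\alpha+\beta\in\Phi^+$ imply $\alpha+\beta\in\mathcal P$; a pattern $\mathcal K\subseteq\mathcal P$ is normal in $\mathcal P$ if $\delta\in\mathcal K$, $\beta\in\mathcal P$ and $\delta+\beta\in\mathcal P$ imply $\delta+\beta\in\mathcal K$. Let $\mathcal P$ be any pattern and $\mathcal K$ any normal pattern in $\mathcal P$ with $\mathcal P\setminus\mathcal K=\mathcal S$, and let $X_{\mathcal P}$, $X_{\mathcal K}$ be the subgroups of $U$ generated by the $X_\alpha$ with $\alpha\in\mathcal P$, respectively $\alpha\in\mathcal K$. Then $X_{\mathcal K}\trianglelefteq X_{\mathcal P}$, and for the quattern group $X_{\mathcal S}=X_{\mathcal P}/X_{\mathcal K}$ and $$\operatorname{Irr}(X_{\mathcal S})_{\mathcal Z}=\{\chi\in\operatorname{Irr}(X_{\mathcal S})\mid X_\alpha\not\subseteq\ker\chi\text{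 for all }\alpha\in\mathcal Z\}$$ the following holds, where $\phi(t)=e^{2\pi i\operatorname{Tr}(t)/p}$ for $t\in\mathbb F_q$, with $\operatorname{Tr}$ the trace of $\mathbb F_q$ over $\mathbb F_p$. (1) If $p\ne3$, then $\operatorname{Irr}(X_{\mathcal S})_{\mathcal Z}$ consists of $(q-1)^6$ characters, all of degree $q^5$. They are parametrized bijectively as $\chi^{a}$ by $a=(a_{12},a_{16},a_{18},a_{22},a_{24},a_{25})\in(\mathbb F_q^\times)^6$, where $\chi^a(x_i(t))=\chi^a(1)\,\phi(a_it)$ for all $\alpha_i\in\mathcal Z$ and $t\in\mathbb F_q$. (2) If $p=3$, then $\operatorname{Irr}(X_{\mathcal S})_{\mathcal Z}$ consists of $q^2(q-1)^6$ characters, all of degree $q^4$. They are parametrized bijectively as $\chi^a_{b_1,b_2}$ by $a\in(\mathbb F_q^\times)^6$ as in (1) and $b_1,b_2\in\mathbb F_q$, where again $\chi^a_{b_1,b_2}(x_i(t))=\chi^a_{b_1,b_2}(1)\,\phi(a_it)$ for $\alpha_i\in\mathcal Z$. Moreover, the parametrizations of the root subgroups being fixed by a suitable choice of the signs of the structure constants,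 $\chi^a_{b_1,b_2}$ is induced from the linear character of the subgroup generated by all $$x_{1,6,7,14}(t)=x_1(a_{18}a_{24}a_{25}t)\,x_6(a_{18}a_{22}a_{24}t)\,x_7(a_{16}a_{22}a_{24}t)\,x_{14}(-a_{12}a_{18}a_{25}t)\,x_{22}(\tfrac12a_{12}a_{16}a_{18}a_{22}a_{24}a_{25}t^2),$$ $$x_{4,6,7,13}(t)=x_4(a_{18}a_{25}t)\,x_6(a_{18}a_{24}t)\,x_7(2a_{16}a_{24}t)\,x_{13}(-a_{16}a_{18}t)\,x_{12}(a_{16}a_{18}a_{24}a_{25}t^2),$$ by $X_9,X_{10},X_{11},X_{19}$ and by the $X_\alpha$ with $\alpha\in\mathcal Z$, whose values are $\phi(b_1t)$ at $x_{1,6,7,14}(t)$, $\phi(b_2t)$ at $x_{4,6,7,13}(t)$, $1$ on $X_9,X_{10},X_{11},X_{19}$, and $\phi(a_it)$ at $x_i(t)$ for $\alpha_i\in\mathcal Z$. -/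

import Mathlib

open scoped Matrix

namespace UE6

/-! ### The root system of type `E₆` -/

/-- Elements of the root lattice of type `E₆`, in coordinates with respect to the simple roots
`α₁, …, α₆` (Bourbaki labelling). -/
abbrev Lat : Type := Fin 6 → ℤ

/-- The invariant bilinear form on the root lattice, normalized by `(α, α) = 2` for roots. -/
def form (a b : Lat) : ℤ := a ⬝ᵥ (CartanMatrix.E₆ *ᵥ b)

/-- The roots of type `E₆` are the vectors of norm `2` of the root lattice. -/
def IsRoot (a : Lat) : Prop := form a a = 2

instance (a : Lat) : Decidable (IsRoot a) := inferInstanceAs (Decidable (_ = _))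

/-- The set `Φ⁺` of positive roots. -/
def posRoots : Set Lat := {a | IsRoot a ∧ 0 ≤ a}

/-- The type of all roots. -/
abbrev Root : Type := {a : Lat // IsRoot a}

theorem isRoot_neg {a : Lat} (h : IsRoot a) : IsRoot (-a) := by
  simpa [IsRoot, form, Matrix.mulVec_neg] using h

/-- The root `-α`. -/
def Root.neg (α : Root) : Root := ⟨-α.1, isRoot_neg α.2⟩

/-- The positive roots in the usual order (by height, then lexicographically from the left);
the value `0` at the other indices is never used. -/
def root : ℕ → Lat
  | 1 => ![1, 0, 0, 0, 0, 0]
  | 2 => ![0, 1, 0, 0, 0, 0]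
  | 3 => ![0, 0, 1, 0, 0, 0]
  | 4 => ![0, 0, 0, 1, 0, 0]
  | 5 => ![0, 0, 0, 0, 1, 0]
  | 6 => ![0, 0, 0, 0, 0, 1]
  | 7 => ![1, 0, 1, 0, 0, 0]
  | 8 => ![0, 1, 0, 1, 0, 0]
  | 9 => ![0, 0, 1, 1, 0, 0]
  | 10 => ![0, 0, 0, 1, 1, 0]
  | 11 => ![0, 0, 0, 0, 1, 1]
  | 12 => ![1, 0, 1, 1, 0, 0]
  | 13 => ![0, 1, 1, 1, 0, 0]
  | 14 => ![0, 1, 0, 1, 1, 0]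
  | 15 => ![0, 0, 1, 1, 1, 0]
  | 16 => ![0, 0, 0, 1, 1, 1]
  | 17 => ![1, 1, 1, 1, 0, 0]
  | 18 => ![1, 0, 1, 1, 1, 0]
  | 19 => ![0, 1, 1, 1, 1, 0]
  | 20 => ![0, 1, 0, 1, 1, 1]
  | 21 => ![0, 0, 1, 1, 1, 1]
  | 22 => ![1, 1, 1, 1, 1, 0]
  | 23 => ![1, 0, 1, 1, 1, 1]
  | 24 => ![0, 1, 1, 2, 1, 0]
  | 25 => ![0, 1, 1, 1, 1, 1]
  | 26 => ![1, 1, 1, 2, 1, 0]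
  | 27 => ![1, 1, 1, 1, 1, 1]
  | 28 => ![0, 1, 1, 2, 1, 1]
  | 29 => ![1, 1, 2, 2, 1, 0]
  | 30 => ![1, 1, 1, 2, 1, 1]
  | 31 => ![0, 1, 1, 2, 2, 1]
  | 32 => ![1, 1, 2, 2, 1, 1]
  | 33 => ![1, 1, 1, 2, 2, 1]
  | 34 => ![1, 1, 2, 2, 2, 1]
  | 35 => ![1, 1, 2, 3, 2, 1]
  | 36 => ![1, 2, 2, 3, 2, 1]
  | _ => 0

/-! ### The Chevalley group `UE₆(q)` and its root subgroups -/

/-- The structure constants: `sgn a b = (-1) ^ c(a, b)`, where `c` is the bilinear form with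
`c(αᵢ, αᵢ) = 1` and `c(αᵢ, αⱼ) = 1` for exactly one orientation of each edge of the Dynkin
diagram, so that `c(a, a) ≡ (a, a) / 2` and `c(a, b) + c(b, a) ≡ (a, b)` modulo `2`. -/
def sgn (a b : Lat) : ℤ :=
  (Int.negOnePow (a ⬝ᵥ b +
    (a 2 * b 0 + a 3 * b 2 + a 4 * b 3 + a 5 * b 4 + a 1 * b 3)) : ℤˣ)

section Chevalley

variable (F : Type*) [Field F]

/-- The Lie algebra of type `E₆` over `F`, obtained from the `ℤ`-form with basis the simple
coroots `hᵢ` and the root vectors `e_β`: the pair `(h, f)` stands for `∑ h i • hᵢ + ∑ f β • e_β`.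
Its bracket is `[h, e_β] = β(h) e_β`, `[e_α, e_β] = sgn α β • e_{α+β}` if `α + β` is a root,
`[e_α, e_{-α}] = -h_α` (`h_α` the coroot of `α`), all other brackets of basis vectors being `0`. -/
abbrev LieE6 : Type _ := (Fin 6 → F) × (Root → F)

variable {F}

/-- The value `α(h)` of the root `α` on `h = ∑ h i • hᵢ`. -/
def evalRoot (α : Root) (h : Fin 6 → F) : F :=
  ∑ j, ((α.1 ᵥ* CartanMatrix.E₆) j : F) * h j

/-- The operator `ad e_α` on the Lie algebra of type `E₆`. -/
def adE (α : Root) : LieE6 F →ₗ[F] LieE6 F where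
  toFun v :=
    (fun i => -(v.2 α.neg * (α.1 i : F)),
     fun β => if h : IsRoot (β.1 - α.1) then (sgn α.1 (β.1 - α.1) : F) * v.2 ⟨β.1 - α.1, h⟩
       else if β = α then -evalRoot α v.1 else 0)
  map_add' v w := by
    ext i
    · simp; ring
    · simp only [Prod.snd_add, Pi.add_apply]
      split_ifs
      · ring
      · simp [evalRoot, mul_add, Finset.sum_add_distrib]; ring
      · simp
  map_smul' c v := by
    ext i
    · simp; ring
    · simp only [Prod.smul_snd, Pi.smul_apply, smul_eq_mul, RingHom.id_apply]
      split_ifs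
      · ring
      · simp only [evalRoot, Prod.smul_fst, Pi.smul_apply, smul_eq_mul, mul_neg, Finset.mul_sum]
        congr 1
        exact Finset.sum_congr rfl fun j _ => by ring
      · simp

/-- The operator `(ad e_α)² / 2`, which is integral: it sends `e_{-α}` to `e_α` and all other
basis vectors to `0`. -/
def adEHalfSq (α : Root) : LieE6 F →ₗ[F] LieE6 F where
  toFun v := (0, fun β => if β = α then v.2 α.neg else 0)
  map_add' v w := by
    ext i
    · simp
    · simp only [Prod.snd_add, Pi.add_apply]
      split_ifs <;> simp
  map_smul' c v := by
    ext i
    · simp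
    · simp only [Prod.smul_snd, Pi.smul_apply, smul_eq_mul, RingHom.id_apply]
      split_ifs <;> simp

/-- `exp (t ad e_α) = 1 + t ad e_α + t² (ad e_α)² / 2` as a linear map; `(ad e_α)³ = 0`. -/
def expAd (α : Root) (t : F) : LieE6 F →ₗ[F] LieE6 F :=
  LinearMap.id + t • adE α + t ^ 2 • adEHalfSq α

theorem form_self_sub (a b : Lat) : form (b - a) (b - a) = form b b - 2 * form a b + form a a := by
  simp [form, dotProduct, Matrix.mulVec, CartanMatrix.E₆, Fin.sum_univ_succ]
  ring

theorem neg_ne (α : Root) : α.neg ≠ α := by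
  intro h
  have h1 : (-α.1 : Lat) = α.1 := congrArg Subtype.val h
  have h2 : α.1 = 0 := by
    funext i
    have := congrFun h1 i
    simp only [Pi.neg_apply] at this
    simp only [Pi.zero_apply]
    omega
  have h3 := α.2
  rw [h2] at h3
  simp [IsRoot, form] at h3

theorem not_isRoot_zero : ¬ IsRoot (0 : Lat) := by simp [IsRoot, form]

theorem not_isRoot_neg_sub (α : Root) : ¬ IsRoot (α.neg.1 - α.1) := by
  have h : form α.1 α.neg.1 = -2 := by
    have := α.2
    simp only [IsRoot, form] at this
    simp [form, Root.neg, Matrix.mulVec_neg, this]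
  have h1 := α.neg.2
  have h2 := α.2
  simp only [IsRoot] at h1 h2 ⊢
  rw [form_self_sub, h, h1, h2]
  norm_num

theorem adE_adE (α : Root) (v : LieE6 F) : adE α (adE α v) = (2 : F) • adEHalfSq α v := by
  ext i
  · simp [adE, adEHalfSq, not_isRoot_neg_sub, neg_ne]
  · simp only [adE, adEHalfSq, LinearMap.coe_mk, AddHom.coe_mk, Prod.smul_snd, Pi.smul_apply,
      smul_eq_mul]
    have hα := α.2
    have hi := i.2
    by_cases h : IsRoot (i.1 - α.1)
    · have hne : i ≠ α := by
        rintro rfl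
        exact not_isRoot_zero (by simpa using h)
      rw [dif_pos h, if_neg hne]
      have h' := h
      simp only [IsRoot] at h' hα hi
      have h1 : ¬ IsRoot (i.1 - α.1 - α.1) := by
        intro h2
        simp only [IsRoot] at h2
        rw [form_self_sub] at h' h2
        have h3 : form α.1 (i.1 - α.1) = form α.1 i.1 - form α.1 α.1 := by
          simp [form, Matrix.mulVec_sub, dotProduct_sub]
        have h4 := form_self_sub α.1 i.1
        omega
      have h2 : (⟨i.1 - α.1, h⟩ : Root) ≠ α := by
        intro h2
        have h3 : i.1 - α.1 = α.1 := congrArg Subtype.val h2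
        have h4 : form α.1 (i.1 - α.1) = form α.1 i.1 - form α.1 α.1 := by
          simp [form, Matrix.mulVec_sub, dotProduct_sub]
        rw [form_self_sub] at h'
        rw [h3] at h4
        omega
      rw [dif_neg h1, if_neg h2]
      simp
    · rw [dif_neg h]
      split_ifs
      · have h2 : ((2 : ℤ) : F) = 2 := by norm_num
        have h3 : evalRoot α (fun i => (α.1 i : F)) = 2 := by
          rw [← h2, ← (hα : form α.1 α.1 = 2)]
          rw [form, Matrix.dotProduct_mulVec]
          simp [evalRoot, dotProduct]
        have h4 : evalRoot α (fun i => -(v.2 α.neg * (α.1 i : F)))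
            = -(v.2 α.neg * evalRoot α (fun i => (α.1 i : F))) := by
          simp only [evalRoot, Finset.mul_sum, ← Finset.sum_neg_distrib]
          exact Finset.sum_congr rfl fun j _ => by ring
        rw [h4, h3]
        ring
      · simp

theorem adE_adEHalfSq (α : Root) (v : LieE6 F) : adE α (adEHalfSq α v) = 0 := by
  ext i
  · simp [adE, adEHalfSq, neg_ne]
  · have h0 : evalRoot α (0 : Fin 6 → F) = 0 := by simp [evalRoot]
    simp only [adE, adEHalfSq, LinearMap.coe_mk, AddHom.coe_mk, Prod.snd_zero, Pi.zero_apply, h0,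
      neg_zero, ite_self]
    split_ifs with h h1
    · exfalso
      have h3 : i.1 - α.1 = α.1 := congrArg Subtype.val h1
      have h4 : form α.1 (i.1 - α.1) = form α.1 i.1 - form α.1 α.1 := by
        simp [form, Matrix.mulVec_sub, dotProduct_sub]
      have hα := α.2
      have hi := i.2
      simp only [IsRoot] at h hα hi
      rw [form_self_sub] at h
      rw [h3] at h4
      omega
    · simp
    · rfl

theorem adEHalfSq_adE (α : Root) (v : LieE6 F) : adEHalfSq α (adE α v) = 0 := by
  ext i
  · simp [adE, adEHalfSq]
  · simp [adE, adEHalfSq, not_isRoot_neg_sub, neg_ne]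

theorem adEHalfSq_adEHalfSq (α : Root) (v : LieE6 F) : adEHalfSq α (adEHalfSq α v) = 0 := by
  ext i
  · simp [adEHalfSq]
  · simp [adEHalfSq, neg_ne]

theorem expAd_expAd (α : Root) (s t : F) (v : LieE6 F) :
    expAd α s (expAd α t v) = expAd α (s + t) v := by
  simp only [expAd, LinearMap.add_apply, LinearMap.smul_apply, LinearMap.id_apply, map_add,
    map_smul, adE_adE, adE_adEHalfSq, adEHalfSq_adE, adEHalfSq_adEHalfSq]
  module

/-- The root element `x_α(t) = exp (t ad e_α)` of the Chevalley group of type `E₆` over `F`. -/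
def x (α : Root) (t : F) : LieE6 F ≃ₗ[F] LieE6 F :=
  { expAd α t with
    invFun := expAd α (-t)
    left_inv := fun v => by
      change expAd α (-t) (expAd α t v) = v
      rw [expAd_expAd]; simp [expAd]
    right_inv := fun v => by
      change expAd α t (expAd α (-t) v) = v
      rw [expAd_expAd]; simp [expAd] }

variable (F)

/-- The subgroup `X_P` generated by the root subgroups `X_α`, `α ∈ P`. In particular
`X posRoots` is the group `UE₆(q)` when `F` is the field with `q` elements. -/
def X (P : Set Lat) : Subgroup (LieE6 F ≃ₗ[F] LieE6 F) :=
  Subgroup.closure {g | ∃ (α : Root) (t : F), α.1 ∈ P ∧ g = x α t}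

end Chevalley

/-! ### Patterns and quattern groups -/

/-- A pattern (closed subset) of `Φ⁺`. -/
def IsPattern (P : Set Lat) : Prop :=
  P ⊆ posRoots ∧ ∀ α ∈ P, ∀ β ∈ P, α + β ∈ posRoots → α + β ∈ P

/-- `K` is a normal pattern in the pattern `P`. -/
def IsNormalPattern (K P : Set Lat) : Prop :=
  IsPattern P ∧ IsPattern K ∧ K ⊆ P ∧ ∀ δ ∈ K, ∀ β ∈ P, δ + β ∈ P → δ + β ∈ K

section Quattern

variable (F : Type*) [Field F] (P K : Set Lat)

/-- `X_K` as a subgroup of `X_P`. -/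
abbrev XIn : Subgroup (X F P) := (X F K).subgroupOf (X F P)

variable [(XIn F P K).Normal]

/-- The quattern group `X_S = X_P / X_K`, where `S = P \ K`. -/
abbrev QuatternGroup : Type _ := X F P ⧸ XIn F P K

variable {F}

open Classical in
/-- The image of the root element `x_α(t)` in the quattern group, for a root `α ∈ P`
(the value `1` in the other cases is never used). -/
noncomputable def xq (α : Lat) (t : F) : QuatternGroup F P K :=
  if h : IsRoot α ∧ α ∈ P then
    QuotientGroup.mk ⟨x ⟨α, h.1⟩ t, Subgroup.subset_closure ⟨⟨α, h.1⟩, t, h.2, rfl⟩⟩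
  else 1

end Quattern

/-! ### Characters -/

section Characters

variable (G : Type*) [Group G]

/-- The set `Irr(G)` of irreducible complex characters of `G`. -/
def Irr : Set (G → ℂ) :=
  {χ | ∃ (n : ℕ) (ρ : Representation ℂ G (Fin n → ℂ)), ρ.IsIrreducible ∧ χ = ρ.character}

variable {G}

/-- The kernel of a character. -/
def charKer (χ : G → ℂ) : Set G := {g | χ g = χ 1}

open Classical in
/-- The induced character `Ind_H^G ψ` of a linear character `ψ` of a subgroup `H` of the finite
group `G`: `g ↦ |H|⁻¹ ∑_{y ∈ G} ψ°(y⁻¹ g y)`, where `ψ°` extends `ψ` by `0`. -/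
noncomputable def indChar (H : Subgroup G) (ψ : H →* ℂˣ) (g : G) : ℂ :=
  (Nat.card H : ℂ)⁻¹ *
    ∑ᶠ y : G, if h : y⁻¹ * g * y ∈ H then (ψ ⟨y⁻¹ * g * y, h⟩ : ℂ) else 0

end Characters

/-- The set `Irr(X_S)_Z` of the irreducible characters of the quattern group `X_S = X_P / X_K`
with central root support `Z`: those whose kernel contains no `X_α` with `α ∈ Z`. -/
def IrrSupp (F : Type*) [Field F] (P K : Set Lat) [(XIn F P K).Normal] (Z : Set Lat) :
    Set (QuatternGroup F P K → ℂ) :=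
  {χ | χ ∈ Irr (QuatternGroup F P K) ∧
    ∀ α ∈ Z, ¬ Set.range (fun t : F => xq P K α t) ⊆ charKer χ}

/-- The character `φ(t) = exp (2πi Tr(t) / p)` of the additive group of `F`. -/
noncomputable def phi (p : ℕ) [Fact p.Prime] {F : Type*} [Field F] [Algebra (ZMod p) F]
    (t : F) : ℂ :=
  ZMod.stdAddChar (Algebra.trace (ZMod p) F t)

/-! ### The `[6, 16, 12]`-core -/

/-- The quattern `S` of the `[6, 16, 12]`-core. -/
def coreS : Finset Lat :=
  ({1, 4, 6, 7, 9, 10, 11, 12, 13, 14, 16, 18, 19, 22, 24, 25} : Finset ℕ).image root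

/-- The indices of the six central roots of the core. -/
def zIdx : Fin 6 → ℕ := ![12, 16, 18, 22, 24, 25]

/-- The set `Z` of central roots of the core. -/
def coreZ : Finset Lat := Finset.univ.image (fun k => root (zIdx k))

/-- The core has the form `[6, 16, 12]` (each sum `α + β = γ` in `S` is counted twice). -/
theorem core_form : coreZ.card = 6 ∧ coreS.card = 16 ∧
    ((coreS ×ˢ coreS).filter (fun v => v.1 + v.2 ∈ coreS)).card = 2 * 12 := by
  decide +kernel

/-- `Z` consists of all the central roots of `S`. -/
theorem coreZ_eq : coreZ = coreS.filter (fun γ => ∀ α ∈ coreS, γ + α ∉ coreS) := by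
  decide +kernel

/-- The core is irreducible: no pair `(β, δ)` satisfies the conditions for a further reduction. -/
theorem core_irreducible : ¬ ∃ γ ∈ coreZ, ∃ δ ∈ coreS.erase γ, ∃ β ∈ coreS.erase γ,
    δ + β = γ ∧ (∀ α ∈ coreS, ∀ α' ∈ coreS, α + α' ≠ β) ∧
      ∀ α ∈ coreS.erase β, δ + α ∉ coreS := by
  decide +kernel

/-- `P = Φ⁺ \ {α₂, α₃, α₅, α₁₅}`. -/
def coreP : Finset Lat := ((Finset.Icc 1 36) \ {2, 3, 5, 15}).image root

/-- `S` is a quattern. -/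
theorem core_isQuattern : IsNormalPattern ↑(coreP \ coreS) ↑coreP ∧
    (↑coreP \ ↑(coreP \ coreS) : Set Lat) = ↑coreS := by
  have h1 : ∀ α ∈ coreP, IsRoot α ∧ ∀ i, 0 ≤ α i := by decide +kernel
  have h2 : ∀ α ∈ coreP, ∀ β ∈ coreP, IsRoot (α + β) → α + β ∈ coreP := by decide +kernel
  have h3 : ∀ α ∈ coreP \ coreS, ∀ β ∈ coreP, α + β ∈ coreP → α + β ∈ coreP \ coreS := by
    decide +kernel
  have h4 : coreP \ (coreP \ coreS) = coreS := by decide +kernel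
  have hK : ∀ α ∈ coreP \ coreS, α ∈ coreP := fun α h => (Finset.mem_sdiff.mp h).1
  refine ⟨⟨⟨fun α h => h1 α h, fun α hα β hβ h => h2 α hα β hβ h.1⟩,
    ⟨fun α h => h1 α (hK α h), fun α hα β hβ h =>
      h3 α hα β (hK β hβ) (h2 α (hK α hα) β (hK β hβ) h.1)⟩,
    fun α h => hK α h, fun α hα β hβ h => h3 α hα β hβ h⟩, ?_⟩
  rw [← Finset.coe_sdiff, h4]

/-! ### Labels of the characters -/

section Labels

variable (p : ℕ) [Fact p.Prime] {F : Type*} [Field F] [Algebra (ZMod p) F]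
  (P K : Set Lat) [(XIn F P K).Normal]

/-- The label `(a₁₂, a₁₆, a₁₈, a₂₂, a₂₄, a₂₅)` of a character: it is a multiple of
`x_i(t) ↦ φ(aᵢ t)` on the root subgroup `X_i`, for each central root `αᵢ` of the core. -/
def HasCentralLabel (a : Fin 6 → Fˣ) (χ : QuatternGroup F P K → ℂ) : Prop :=
  ∀ (k : Fin 6) (t : F), χ (xq P K (root (zIdx k)) t) = χ 1 * phi p ((a k : F) * t)

variable {P K}

/-- The diagonal element `x_{1,6,7,14}(t)`, normalized by a factor in `X₂₂` which makes it
additive in `t`. -/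
noncomputable def x1' (P K : Set Lat) [(XIn F P K).Normal] (a : Fin 6 → Fˣ) (t : F) :
    QuatternGroup F P K :=
  let a12 : F := a 0
  let a16 : F := a 1
  let a18 : F := a 2
  let a22 : F := a 3
  let a24 : F := a 4
  let a25 : F := a 5
  xq P K (root 1) (a18 * a24 * a25 * t) * xq P K (root 6) (a18 * a22 * a24 * t) *
    xq P K (root 7) (a16 * a22 * a24 * t) * xq P K (root 14) (-(a12 * a18 * a25 * t)) *
    xq P K (root 22) (a12 * a16 * a18 * a22 * a24 * a25 * t ^ 2 / 2)

/-- The diagonal element `x_{4,6,7,13}(t)`, normalized by a factor in `X₁₂` which makes it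
additive in `t`. -/
noncomputable def x2' (P K : Set Lat) [(XIn F P K).Normal] (a : Fin 6 → Fˣ) (t : F) :
    QuatternGroup F P K :=
  let a16 : F := a 1
  let a18 : F := a 2
  let a24 : F := a 4
  let a25 : F := a 5
  xq P K (root 4) (a18 * a25 * t) * xq P K (root 6) (a18 * a24 * t) *
    xq P K (root 7) (2 * a16 * a24 * t) * xq P K (root 13) (-(a16 * a18 * t)) *
    xq P K (root 12) (a16 * a18 * a24 * a25 * t ^ 2)

/-- The subgroup `X' X_J X_Z` of the quattern group, `J = {α₉, α₁₀, α₁₁, α₁₉}`, generated by the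
elements `x_{1,6,7,14}(t)` and `x_{4,6,7,13}(t)` and by the root subgroups of `J` and `Z`. -/
noncomputable def labelSubgroup (P K : Set Lat) [(XIn F P K).Normal] (a : Fin 6 → Fˣ) :
    Subgroup (QuatternGroup F P K) :=
  Subgroup.closure ({g | ∃ t, g = x1' P K a t} ∪ {g | ∃ t, g = x2' P K a t} ∪
    {g | ∃ j ∈ ({9, 10, 11, 19} : Finset ℕ), ∃ t : F, g = xq P K (root j) t} ∪
    {g | ∃ (k : Fin 6) (t : F), g = xq P K (root (zIdx k)) t})

/-- The linear character `ψ` of `X' X_J X_Z` is the one with label `(a, b)`: it is trivial on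
`X_J`, it is `x_i(t) ↦ φ(aᵢ t)` on the central root subgroups, and it takes the values
`φ(b₁ t)` at `x_{1,6,7,14}(t)` and `φ(b₂ t)` at `x_{4,6,7,13}(t)`. -/
def IsLabelChar (a : Fin 6 → Fˣ) (b : F × F) (ψ : labelSubgroup P K a →* ℂˣ) : Prop :=
  ∀ (h : labelSubgroup P K a) (t : F),
    (h.1 = x1' P K a t → (ψ h : ℂ) = phi p (b.1 * t)) ∧
    (h.1 = x2' P K a t → (ψ h : ℂ) = phi p (b.2 * t)) ∧
    (∀ j ∈ ({9, 10, 11, 19} : Finset ℕ), h.1 = xq P K (root j) t → (ψ h : ℂ) = 1) ∧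
    (∀ k : Fin 6, h.1 = xq P K (root (zIdx k)) t → (ψ h : ℂ) = phi p ((a k : F) * t))

end Labels

end UE6

/-
The action of the root elements on the Lie algebra gives the commutator formula, and the leading
coefficient of a product at a root of minimal height of the pattern gives the uniqueness of ordered
products of root elements. Hence, whatever `P` and `K` are, `X_S` is the central extension of
`F ^ 10` by `F ^ 6` defined by one explicit bilinear cocycle.

In a finite group, a linear character `λ` of a subgroup `R` whose extension `d • λ` by zero is a
class function of norm one affords an irreducible character. For the central character with label
`a` this applies to the preimage `R` of the radical of the alternating form which `a` composed with
the commutator map defines on `F ^ 10`. As all labels are nonzero, the radical vanishes if `3 ≠ 0`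
in `F`, so there is one character, of degree `q ^ 5`; it is a plane if `3 = 0`, so there are `q ^ 2`
characters, of degree `q ^ 4`, which are induced from any linear extensions to the preimage of a
maximal isotropic subspace.
-/

namespace UE6

open scoped commutatorElement

/-! ### The bilinear form and the structure constants -/

theorem form_add_left (a b c : Lat) : form (a + b) c = form a c + form b c := by
  simp [form, add_dotProduct]

theorem form_add_right (a b c : Lat) : form a (b + c) = form a b + form a c := by
  simp [form, Matrix.mulVec_add, dotProduct_add]

theorem form_neg_left (a b : Lat) : form (-a) b = -form a b := by
  simp [form]

theorem form_neg_right (a b : Lat) : form a (-b) = -form a b := by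
  simp [form, Matrix.mulVec_neg]

theorem form_comm (a b : Lat) : form a b = form b a := by
  simp [form, dotProduct, Matrix.mulVec, CartanMatrix.E₆, Fin.sum_univ_succ]
  ring

theorem form_self_add (a b : Lat) : form (a + b) (a + b) = form a a + 2 * form a b + form b b := by
  rw [form_add_left, form_add_right, form_add_right, form_comm b a]
  ring

theorem form_self_eq (a : Lat) : form a a =
    2 * (a ⬝ᵥ a - (a 0 * a 2 + a 2 * a 3 + a 3 * a 4 + a 4 * a 5 + a 1 * a 3)) := by
  simp [form, dotProduct, Matrix.mulVec, CartanMatrix.E₆, Fin.sum_univ_succ]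
  ring

theorem six_mul_form_self (a : Lat) : 6 * form a a =
    3 * (2 * a 0 - a 2) ^ 2 + (3 * a 2 - 2 * a 3) ^ 2 + 3 * (2 * a 5 - a 4) ^ 2 +
      (3 * a 4 - 2 * a 3) ^ 2 + 3 * (2 * a 1 - a 3) ^ 2 + a 3 ^ 2 := by
  simp [form, dotProduct, Matrix.mulVec, CartanMatrix.E₆, Fin.sum_univ_succ]
  ring

theorem form_self_nonneg (a : Lat) : 0 ≤ form a a := by
  have : 0 ≤ 6 * form a a := by rw [six_mul_form_self]; positivity
  omega

theorem eq_zero_of_form_self {a : Lat} (h : form a a = 0) : a = 0 := by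
  have hsum := six_mul_form_self a
  have h0 : (2 * a 0 - a 2) ^ 2 = 0 := by nlinarith
  have h2 : (3 * a 2 - 2 * a 3) ^ 2 = 0 := by nlinarith
  have h5 : (2 * a 5 - a 4) ^ 2 = 0 := by nlinarith
  have h4 : (3 * a 4 - 2 * a 3) ^ 2 = 0 := by nlinarith
  have h1 : (2 * a 1 - a 3) ^ 2 = 0 := by nlinarith
  have h3 : a 3 ^ 2 = 0 := by nlinarith
  rw [sq_eq_zero_iff] at h0 h1 h2 h3 h4 h5
  funext i
  fin_cases i <;> simp only [Fin.reduceFinMk, Pi.zero_apply] <;> lia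

theorem eq_of_form_eq_two {a b : Lat} (ha : IsRoot a) (hb : IsRoot b) (h : form a b = 2) :
    b = a := by
  apply sub_eq_zero.mp
  apply eq_zero_of_form_self
  rw [form_self_sub, h, ha, hb]
  norm_num

theorem eq_neg_of_form_eq_neg_two {a b : Lat} (ha : IsRoot a) (hb : IsRoot b)
    (h : form a b = -2) : b = -a :=
  eq_of_form_eq_two (isRoot_neg ha) hb (by rw [form_neg_left, h]; norm_num)

theorem form_le_two {a b : Lat} (ha : IsRoot a) (hb : IsRoot b) : form a b ≤ 2 := by
  have h := form_self_nonneg (b - a)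
  rw [form_self_sub, ha, hb] at h
  omega

theorem form_le_one {a b : Lat} (ha : IsRoot a) (hb : IsRoot b) (hne : b ≠ a) :
    form a b ≤ 1 := by
  have h := form_le_two ha hb
  have h' : form a b ≠ 2 := fun h => hne (eq_of_form_eq_two ha hb h)
  omega

theorem neg_two_le_form {a b : Lat} (ha : IsRoot a) (hb : IsRoot b) : -2 ≤ form a b := by
  have := form_le_two (isRoot_neg ha) hb
  rw [form_neg_left] at this
  omega

theorem isRoot_sub_iff {a b : Lat} (ha : IsRoot a) (hb : IsRoot b) :
    IsRoot (b - a) ↔ form a b = 1 := by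
  rw [IsRoot, form_self_sub, ha, hb]
  omega

theorem isRoot_add_iff {a b : Lat} (ha : IsRoot a) (hb : IsRoot b) :
    IsRoot (a + b) ↔ form a b = -1 := by
  have h := isRoot_sub_iff (isRoot_neg ha) hb
  rw [sub_neg_eq_add, add_comm b a, form_neg_left] at h
  rw [h]
  omega

theorem sgn_add_left (a b c : Lat) : sgn (a + b) c = sgn a c * sgn b c := by
  simp only [sgn, ← Units.val_mul, ← Int.negOnePow_add]
  congr 2
  simp only [add_dotProduct, Pi.add_apply]
  ring

theorem sgn_add_right (a b c : Lat) : sgn a (b + c) = sgn a b * sgn a c := by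
  simp only [sgn, ← Units.val_mul, ← Int.negOnePow_add]
  congr 2
  simp only [dotProduct_add, Pi.add_apply]
  ring

theorem sgn_neg_right (a b : Lat) : sgn a (-b) = sgn a b := by
  simp only [sgn]
  rw [← Int.negOnePow_neg]
  congr 2
  simp only [dotProduct_neg, Pi.neg_apply]
  ring

theorem sgn_sub_right (a b c : Lat) : sgn a (b - c) = sgn a b * sgn a c := by
  rw [sub_eq_add_neg, sgn_add_right, sgn_neg_right]

theorem sgn_mul_self (a b : Lat) : sgn a b * sgn a b = 1 := by
  simp [sgn, ← Units.val_mul]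

theorem sgn_comm (a b : Lat) : sgn b a = (Int.negOnePow (form a b) : ℤˣ) * sgn a b := by
  simp only [sgn, ← Units.val_mul, ← Int.negOnePow_add]
  congr 1
  rw [Int.negOnePow_eq_iff]
  refine ⟨b 2 * a 0 + b 3 * a 2 + b 4 * a 3 + b 5 * a 4 + b 1 * a 3 - a ⬝ᵥ b, ?_⟩
  simp [form, dotProduct, Matrix.mulVec, CartanMatrix.E₆, Fin.sum_univ_succ]
  ring

theorem sgn_comm_of_odd {a b : Lat} (h : Odd (form a b)) : sgn b a = -sgn a b := by
  rw [sgn_comm, Int.negOnePow_odd _ h]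
  simp

theorem sgn_comm_of_even {a b : Lat} (h : Even (form a b)) : sgn b a = sgn a b := by
  rw [sgn_comm, Int.negOnePow_even _ h]
  simp

theorem dotProduct_self_of_isRoot {a : Lat} (ha : IsRoot a) :
    a ⬝ᵥ a = 1 + (a 0 * a 2 + a 2 * a 3 + a 3 * a 4 + a 4 * a 5 + a 1 * a 3) := by
  have h := form_self_eq a
  rw [ha] at h
  omega

theorem sgn_self {a : Lat} (ha : IsRoot a) : sgn a a = -1 := by
  rw [sgn, dotProduct_self_of_isRoot ha, Int.negOnePow_odd _
    ⟨a 0 * a 2 + a 2 * a 3 + a 3 * a 4 + a 4 * a 5 + a 1 * a 3, by ring⟩]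
  simp

/-! ### The commutator formula -/

section Commutator

variable {F : Type*} [Field F]

theorem sgn_mul_self_cast (a b : Lat) : (sgn a b * sgn a b : F) = 1 := by
  rw [← Int.cast_mul, sgn_mul_self, Int.cast_one]

/-- The coefficient of `e_a` as a linear form on the Lie algebra, extended by `0` to the lattice
vectors `a` that are not roots. -/
def coeff (a : Lat) : LieE6 F →ₗ[F] F :=
  if h : IsRoot a then LinearMap.proj ⟨a, h⟩ ∘ₗ LinearMap.snd F (Fin 6 → F) (Root → F) else 0

/-- The root vector `e_α`. -/
def e (α : Root) : LieE6 F := (0, Pi.single α 1)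

theorem coeff_root (α : Root) (v : LieE6 F) : coeff α.1 v = v.2 α := by
  simp [coeff, α.2]

theorem coeff_of_not_isRoot {a : Lat} (h : ¬ IsRoot a) (v : LieE6 F) : coeff a v = 0 := by
  simp [coeff, h]

theorem coeff_e (α : Root) (a : Lat) : coeff a (e α : LieE6 F) = if a = α.1 then 1 else 0 := by
  by_cases h : IsRoot a
  · simp [coeff, e, h, Pi.single_apply, Subtype.ext_iff]
  · rw [coeff_of_not_isRoot h, if_neg fun h' => h (by rw [h']; exact α.2)]

theorem lie_ext {v w : LieE6 F} (h₁ : v.1 = w.1) (h₂ : ∀ a, IsRoot a → coeff a v = coeff a w) :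
    v = w :=
  Prod.ext h₁ (funext fun β => by simpa only [coeff_root] using h₂ _ β.2)

theorem evalRoot_coroot (α β : Root) (c : F) :
    evalRoot α (fun i => c * (β.1 i : F)) = c * (form α.1 β.1 : F) := by
  have h : (form α.1 β.1 : F) = ∑ j, ((α.1 ᵥ* CartanMatrix.E₆) j : F) * (β.1 j : F) := by
    rw [form, Matrix.dotProduct_mulVec]
    simp [dotProduct]
  rw [h, evalRoot, Finset.mul_sum]
  exact Finset.sum_congr rfl fun j _ => by ring

theorem evalRoot_add {α β γ : Root} (h : γ.1 = α.1 + β.1) (f : Fin 6 → F) :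
    evalRoot γ f = evalRoot α f + evalRoot β f := by
  simp only [evalRoot, h, Matrix.add_vecMul, Pi.add_apply, Int.cast_add, add_mul,
    Finset.sum_add_distrib]

theorem adE_fst (α : Root) (v : LieE6 F) :
    (adE α v).1 = fun i => -coeff (-α.1) v * (α.1 i : F) := by
  have h : coeff (-α.1) v = v.2 α.neg := coeff_root α.neg v
  simp [adE, h]

theorem coeff_adE_self (α : Root) (v : LieE6 F) : coeff α.1 (adE α v) = -evalRoot α v.1 := by
  simp [coeff_root, adE, not_isRoot_zero]

theorem coeff_adE {α : Root} {a : Lat} (ha : IsRoot a) (hne : a ≠ α.1) (v : LieE6 F) :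
    coeff a (adE α v) = -(sgn α.1 a : F) * coeff (a - α.1) v := by
  have hne' : (⟨a, ha⟩ : Root) ≠ α := fun h => hne (congrArg Subtype.val h)
  rw [coeff_root ⟨a, ha⟩]
  by_cases h : IsRoot (a - α.1)
  · simp [adE, coeff, h, sgn_sub_right, sgn_self α.2]
  · simp [adE, coeff, h, hne']

theorem adEHalfSq_apply (α : Root) (v : LieE6 F) : adEHalfSq α v = coeff (-α.1) v • e α := by
  have h : coeff (-α.1) v = v.2 α.neg := coeff_root α.neg v
  ext i
  · simp [adEHalfSq, e]
  · simp [adEHalfSq, e, h, Pi.single_apply]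

theorem x_apply (α : Root) (t : F) (v : LieE6 F) :
    x α t v = v + t • adE α v + (t ^ 2 * coeff (-α.1) v) • e α := by
  rw [mul_smul, ← adEHalfSq_apply]
  rfl

theorem coeff_neg_adE {α β : Root} (h : α.1 + β.1 ≠ 0) (v : LieE6 F) :
    coeff (-β.1) (adE α v) = -(sgn α.1 β.1 : F) * coeff (-(α.1 + β.1)) v := by
  have hne : -β.1 ≠ α.1 := fun h' => h (by rw [← h', neg_add_cancel])
  rw [coeff_adE (isRoot_neg β.2) hne, sgn_neg_right, neg_add' α.1 β.1, sub_eq_add_neg,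
    sub_eq_add_neg, add_comm (-β.1)]

theorem coeff_neg_adE_of_form_nonneg {α β : Root} (h : 0 ≤ form α.1 β.1) (v : LieE6 F) :
    coeff (-β.1) (adE α v) = 0 := by
  have h0 : α.1 + β.1 ≠ 0 := fun h0 => by
    have := β.2
    rw [eq_neg_of_add_eq_zero_left h0, form_neg_left, this] at h
    omega
  have hroot : ¬ IsRoot (-(α.1 + β.1)) := fun hr => by
    have := (isRoot_add_iff α.2 β.2).1 (by simpa using isRoot_neg hr)
    omega
  rw [coeff_neg_adE h0, coeff_of_not_isRoot hroot, mul_zero]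

theorem adE_e_of_form_nonneg {α β : Root} (h : 0 ≤ form α.1 β.1) :
    adE α (e β : LieE6 F) = 0 := by
  refine lie_ext ?_ fun a ha => ?_
  · have hne : -α.1 ≠ β.1 := fun h' => by
      have := α.2
      rw [← h', form_neg_right, this] at h
      omega
    simp [adE_fst, coeff_e, hne, Pi.zero_def]
  · by_cases haα : a = α.1
    · subst haα
      simp [coeff_adE_self, evalRoot, e]
    · have hne : a - α.1 ≠ β.1 := fun h' => by
        have := (isRoot_add_iff α.2 β.2).1 (by rw [← h']; simpa using ha)
        omega
      simp [coeff_adE ha haα, coeff_e, hne]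

theorem adE_e {α β γ : Root} (h : γ.1 = α.1 + β.1) :
    adE α (e β : LieE6 F) = (sgn α.1 β.1 : F) • e γ := by
  have hβ : β.1 = γ.1 - α.1 := by rw [h, add_sub_cancel_left]
  refine lie_ext ?_ fun a ha => ?_
  · have hne : -α.1 ≠ β.1 := fun h' => not_isRoot_zero <| by
      have := γ.2
      rwa [h, ← h', add_neg_cancel] at this
    ext i
    simp [adE_fst, coeff_e, hne, show (e γ : LieE6 F).1 = 0 from rfl]
  · by_cases haα : a = α.1
    · subst haα
      have hne : α.1 ≠ γ.1 := fun h' => not_isRoot_zero <| by simpa [hβ, ← h'] using β.2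
      simp [coeff_adE_self, evalRoot, coeff_e, hne, show (e β : LieE6 F).1 = 0 from rfl]
    · by_cases haγ : a = γ.1
      · subst haγ
        rw [coeff_adE ha haα]
        simp [coeff_e, h, sgn_add_right, sgn_self α.2]
      · have hne : a - α.1 ≠ β.1 := fun h' => haγ (by rw [h, ← h', add_sub_cancel])
        simp [coeff_adE ha haα, coeff_e, hne, haγ]

open Classical in
theorem coeff_adE_adE {α β : Root} {a : Lat} (ha : IsRoot a) (hα : a ≠ α.1)
    (hαβ : a ≠ α.1 + β.1) (v : LieE6 F) :
    coeff a (adE α (adE β v)) = if form α.1 a = 1 then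
      (sgn α.1 a * sgn β.1 a * sgn β.1 α.1 : F) * coeff (a - (α.1 + β.1)) v else 0 := by
  rw [coeff_adE ha hα]
  split_ifs with h
  · rw [coeff_adE ((isRoot_sub_iff α.2 ha).2 h) fun h' => hαβ (by rw [← h', add_sub_cancel]),
      sgn_sub_right, sub_sub]
    push_cast
    ring
  · rw [coeff_of_not_isRoot fun h' => h ((isRoot_sub_iff α.2 ha).1 h'), mul_zero]

theorem adE_adE_of_form_eq_one {α β : Root} (h : form α.1 β.1 = 1) (v : LieE6 F) :
    adE α (adE β v) = coeff (-β.1) v • e α + coeff (-α.1) v • e β := by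
  have hne : α.1 ≠ β.1 := fun h' => by
    have := β.2
    rw [h', this] at h
    omega
  have hβα : form β.1 α.1 = 1 := form_comm α.1 β.1 ▸ h
  refine lie_ext ?_ fun a ha => ?_
  · simp [adE_fst, coeff_neg_adE_of_form_nonneg (F := F) (hβα ▸ zero_le_one), e, ← Pi.zero_def]
  · simp only [map_add, map_smul, coeff_e, smul_eq_mul]
    by_cases haα : a = α.1
    · subst haα
      rw [coeff_adE_self, adE_fst, evalRoot_coroot, h, if_pos rfl, if_neg hne]
      push_cast
      ring
    · by_cases haβ : a = β.1
      · subst haβ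
        have hroot := (isRoot_sub_iff α.2 β.2).2 h
        have hne' : β.1 - α.1 ≠ β.1 := fun h' => not_isRoot_zero (sub_eq_self.1 h' ▸ α.2)
        have hN := sgn_mul_self_cast (F := F) β.1 α.1
        rw [coeff_adE β.2 haα, coeff_adE hroot hne', sub_sub_cancel_left, if_neg haα, if_pos rfl,
          sgn_sub_right, sgn_self β.2, sgn_comm_of_odd (hβα ▸ odd_one)]
        push_cast
        linear_combination coeff (-α.1) v * hN
      · have h1 := form_le_one α.2 ha haα
        have h2 := form_le_one β.2 ha haβ
        have hroot : ¬ IsRoot (a - (α.1 + β.1)) := fun hr => by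
          rw [IsRoot, form_self_sub, ha, form_add_left, form_self_add, α.2, β.2] at hr
          omega
        have haαβ : a ≠ α.1 + β.1 := fun h' => by
          have := (isRoot_add_iff α.2 β.2).1 (h' ▸ ha)
          omega
        rw [coeff_adE_adE ha haα haαβ, coeff_of_not_isRoot hroot]
        simp [haα, haβ]

theorem not_isRoot_add_of_form_nonneg {α β : Root} (h : 0 ≤ form α.1 β.1) :
    ¬ IsRoot (α.1 + β.1) := fun hr => by
  have := (isRoot_add_iff α.2 β.2).1 hr
  omega

theorem coeff_adE_adE_comm_of_form_eq_zero {α β : Root} (h : form α.1 β.1 = 0) {a : Lat}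
    (ha : IsRoot a) (hα : a ≠ α.1) (v : LieE6 F) :
    coeff a (adE α (adE β v)) = coeff a (adE β (adE α v)) := by
  have hβα : form β.1 α.1 = 0 := form_comm α.1 β.1 ▸ h
  by_cases hβ : a = β.1
  · subst hβ
    have hr : ¬ IsRoot (β.1 - α.1) := fun hr => by
      have := (isRoot_sub_iff α.2 β.2).1 hr
      omega
    rw [coeff_adE ha hα, coeff_of_not_isRoot hr, coeff_adE_self, adE_fst, evalRoot_coroot, hβα]
    simp
  · have hsum := not_isRoot_add_of_form_nonneg h.ge
    have hsum' := not_isRoot_add_of_form_nonneg hβα.ge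
    rw [coeff_adE_adE ha hα fun h' => hsum (h' ▸ ha),
      coeff_adE_adE ha hβ fun h' => hsum' (h' ▸ ha), add_comm β.1]
    by_cases hr : IsRoot (a - (α.1 + β.1))
    · have h1 := form_le_one α.2 ha hα
      have h2 := form_le_one β.2 ha hβ
      rw [IsRoot, form_self_sub, ha, form_add_left, form_self_add, α.2, β.2] at hr
      rw [if_pos (by omega), if_pos (by omega),
        sgn_comm_of_even (a := α.1) (b := β.1) (h ▸ Even.zero)]
      ring
    · simp [coeff_of_not_isRoot hr]

theorem adE_adE_comm_of_form_eq_zero {α β : Root} (h : form α.1 β.1 = 0) (v : LieE6 F) :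
    adE α (adE β v) = adE β (adE α v) := by
  have hβα : form β.1 α.1 = 0 := form_comm α.1 β.1 ▸ h
  refine lie_ext ?_ fun a ha => ?_
  · simp [adE_fst, coeff_neg_adE_of_form_nonneg (F := F) h.ge,
      coeff_neg_adE_of_form_nonneg (F := F) hβα.ge]
  · by_cases hα : a = α.1
    · have hβ : a ≠ β.1 := fun hβ => by
        have := α.2
        rw [IsRoot] at this
        rw [← hβ, hα] at h
        omega
      exact (coeff_adE_adE_comm_of_form_eq_zero hβα ha hβ v).symm
    · exact coeff_adE_adE_comm_of_form_eq_zero h ha hα v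

theorem sgn_add_self_left {α β : Root} (h : form α.1 β.1 = -1) :
    sgn (α.1 + β.1) α.1 = sgn α.1 β.1 := by
  rw [sgn_add_left, sgn_self α.2, sgn_comm_of_odd (a := α.1) (b := β.1) (h ▸ by decide)]
  ring

theorem coeff_add_adE_adE {α β γ : Root} (hγ : γ.1 = α.1 + β.1) (v : LieE6 F) :
    coeff γ.1 (adE α (adE β v)) =
      coeff γ.1 (adE β (adE α v)) + (sgn α.1 β.1 : F) * coeff γ.1 (adE γ v) := by
  have hα : γ.1 - α.1 = β.1 := by rw [hγ, add_sub_cancel_left]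
  have hβ : γ.1 - β.1 = α.1 := by rw [hγ, add_sub_cancel_right]
  have hneα : γ.1 ≠ α.1 := fun h => not_isRoot_zero ((sub_eq_zero.2 h).symm.trans hα ▸ β.2)
  have hneβ : γ.1 ≠ β.1 := fun h => not_isRoot_zero ((sub_eq_zero.2 h).symm.trans hβ ▸ α.2)
  have hcomm : sgn β.1 α.1 = -sgn α.1 β.1 :=
    sgn_comm_of_odd (((isRoot_add_iff α.2 β.2).1 (hγ ▸ γ.2)) ▸ by decide)
  rw [coeff_adE γ.2 hneα, coeff_adE γ.2 hneβ, hα, hβ, coeff_adE_self, coeff_adE_self,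
    coeff_adE_self, evalRoot_add hγ, hγ, sgn_add_right, sgn_add_right, sgn_self α.2,
    sgn_self β.2, hcomm]
  push_cast
  ring

theorem coeff_adE_adE_of_isRoot {α β γ : Root} (hγ : γ.1 = α.1 + β.1) {a : Lat} (ha : IsRoot a)
    (hβ : a ≠ β.1) (v : LieE6 F) : coeff a (adE α (adE β v)) =
      coeff a (adE β (adE α v)) + (sgn α.1 β.1 : F) * coeff a (adE γ v) := by
  have h : form α.1 β.1 = -1 := (isRoot_add_iff α.2 β.2).1 (hγ ▸ γ.2)
  have hN := sgn_mul_self_cast (F := F) α.1 β.1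
  have hcomm : sgn β.1 α.1 = -sgn α.1 β.1 := sgn_comm_of_odd (h ▸ by decide)
  by_cases hα : a = α.1
  · subst hα
    have hr : ¬ IsRoot (α.1 - β.1) := fun hr => by
      have := (isRoot_sub_iff β.2 α.2).1 hr
      rw [form_comm] at this
      omega
    have hne : α.1 ≠ γ.1 := fun h' => not_isRoot_zero <|
      left_eq_add.1 (h'.trans hγ) ▸ β.2
    rw [coeff_adE_self, adE_fst, evalRoot_coroot, h, coeff_adE ha hβ, coeff_of_not_isRoot hr,
      coeff_adE ha hne, hγ, sgn_add_self_left h, sub_add_cancel_left]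
    push_cast
    linear_combination coeff (-β.1) v * hN
  by_cases haγ : a = γ.1
  · exact haγ ▸ coeff_add_adE_adE hγ v
  have hβγ : a ≠ β.1 + α.1 := by rwa [add_comm, ← hγ]
  rw [coeff_adE_adE ha hα (hγ ▸ haγ), coeff_adE_adE ha hβ hβγ, coeff_adE ha haγ, add_comm β.1, hγ,
    sgn_add_left, hcomm]
  by_cases hr : IsRoot (a - (α.1 + β.1))
  · have h1 := form_le_one α.2 ha hα
    have h2 := form_le_one β.2 ha hβ
    have hsum : form α.1 a + form β.1 a = 1 := by
      rw [← form_add_left, ← hγ]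
      exact (isRoot_sub_iff γ.2 ha).1 (hγ ▸ hr)
    by_cases hα1 : form α.1 a = 1
    · rw [if_pos hα1, if_neg (by omega)]
      push_cast
      ring
    · rw [if_neg hα1, if_pos (by omega)]
      push_cast
      ring
  · simp [coeff_of_not_isRoot hr]

theorem coeff_neg_adE_of_isRoot {α β γ : Root} (hγ : γ.1 = α.1 + β.1) (v : LieE6 F) :
    coeff (-β.1) (adE α v) = -(sgn α.1 β.1 : F) * coeff (-γ.1) v := by
  rw [hγ]
  exact coeff_neg_adE (fun h0 => not_isRoot_zero (h0 ▸ hγ ▸ γ.2)) v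

theorem adE_adE_of_isRoot {α β γ : Root} (hγ : γ.1 = α.1 + β.1) (v : LieE6 F) :
    adE α (adE β v) = adE β (adE α v) + (sgn α.1 β.1 : F) • adE γ v := by
  have h : form α.1 β.1 = -1 := (isRoot_add_iff α.2 β.2).1 (hγ ▸ γ.2)
  have hcomm : sgn β.1 α.1 = -sgn α.1 β.1 := sgn_comm_of_odd (h ▸ by decide)
  have hγ' : γ.1 = β.1 + α.1 := hγ.trans (add_comm _ _)
  refine lie_ext ?_ fun a ha => ?_
  · ext i
    simp [adE_fst, coeff_neg_adE_of_isRoot hγ, coeff_neg_adE_of_isRoot hγ', hcomm, hγ]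
    ring
  · rw [map_add, map_smul, smul_eq_mul]
    by_cases hβ : a = β.1
    · have hα : a ≠ α.1 := fun hα => by
        have := α.2
        rw [IsRoot] at this
        rw [← hβ, hα] at h
        omega
      rw [coeff_adE_adE_of_isRoot hγ' ha hα, hcomm]
      push_cast
      ring
    · exact coeff_adE_adE_of_isRoot hγ ha hβ v

theorem coeff_neg_e {α β : Root} (h : form α.1 β.1 ≠ -2) : coeff (-α.1) (e β : LieE6 F) = 0 := by
  rw [coeff_e, if_neg]
  intro h'
  have := α.2
  rw [← h', form_neg_right, this] at h
  omega

theorem x_add (α : Root) (s t : F) : x α (s + t) = x α s * x α t :=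
  LinearEquiv.ext fun v => (expAd_expAd α s t v).symm

theorem x_zero (α : Root) : x α (0 : F) = 1 := by
  ext1 v
  simp [x_apply]

theorem x_neg (α : Root) (t : F) : x α (-t) = (x α t)⁻¹ := by
  rw [eq_inv_iff_mul_eq_one, ← x_add, neg_add_cancel, x_zero]

theorem x_mul_x_of_not_isRoot {α β : Root} (h0 : α.1 + β.1 ≠ 0) (h : ¬ IsRoot (α.1 + β.1))
    (s t : F) : x α s * x β t = x β t * x α s := by
  have hne1 : form α.1 β.1 ≠ -1 := fun h1 => h ((isRoot_add_iff α.2 β.2).2 h1)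
  have hne2 : form α.1 β.1 ≠ -2 := fun h2 =>
    h0 (by rw [eq_neg_of_form_eq_neg_two α.2 β.2 h2, add_neg_cancel])
  have hlb := neg_two_le_form α.2 β.2
  by_cases heq : β = α
  · rw [heq, ← x_add, ← x_add, add_comm]
  have hub := form_le_one α.2 β.2 (Subtype.coe_ne_coe.2 heq)
  have hαβ : 0 ≤ form α.1 β.1 := by omega
  have hβα : 0 ≤ form β.1 α.1 := form_comm α.1 β.1 ▸ hαβ
  have hcomm (v : LieE6 F) : adE α (adE β v) = adE β (adE α v) := by
    obtain h | h : form α.1 β.1 = 0 ∨ form α.1 β.1 = 1 := by omega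
    · exact adE_adE_comm_of_form_eq_zero h v
    · rw [adE_adE_of_form_eq_one h, adE_adE_of_form_eq_one (form_comm α.1 β.1 ▸ h), add_comm]
  ext1 v
  simp only [LinearEquiv.mul_apply, x_apply, map_add, map_smul, hcomm, adE_e_of_form_nonneg hαβ,
    adE_e_of_form_nonneg hβα, coeff_neg_adE_of_form_nonneg hαβ, coeff_neg_adE_of_form_nonneg hβα,
    coeff_neg_e (α := α) hne2, coeff_neg_e (α := β) (form_comm α.1 β.1 ▸ hne2)]
  module

theorem x_mul_x_of_isRoot {α β γ : Root} (hγ : γ.1 = α.1 + β.1) (s t : F) :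
    x α s * x β t = x γ ((sgn α.1 β.1 : F) * s * t) * x β t * x α s := by
  have h : form α.1 β.1 = -1 := (isRoot_add_iff α.2 β.2).1 (hγ ▸ γ.2)
  have hγ' : γ.1 = β.1 + α.1 := hγ.trans (add_comm _ _)
  have hcomm : sgn β.1 α.1 = -sgn α.1 β.1 := sgn_comm_of_odd (h ▸ by decide)
  have hγα : form γ.1 α.1 = 1 := by rw [hγ, form_add_left, α.2, form_comm, h]; norm_num
  have hγβ : form γ.1 β.1 = 1 := by rw [hγ, form_add_left, β.2, h]; norm_num
  have hαγ : 0 ≤ form α.1 γ.1 := form_comm γ.1 α.1 ▸ hγα.ge.trans' zero_le_one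
  have hβγ : 0 ≤ form β.1 γ.1 := form_comm γ.1 β.1 ▸ hγβ.ge.trans' zero_le_one
  have hγα₀ : 0 ≤ form γ.1 α.1 := hγα ▸ zero_le_one
  have hγβ₀ : 0 ≤ form γ.1 β.1 := hγβ ▸ zero_le_one
  have hγγ : form γ.1 γ.1 = 2 := γ.2
  ext1 v
  simp only [LinearEquiv.mul_apply, x_apply, map_add, map_smul, adE_adE_of_isRoot hγ,
    adE_e hγ, adE_e hγ', hcomm, adE_adE_of_form_eq_one hγα, adE_adE_of_form_eq_one hγβ,
    coeff_neg_adE_of_isRoot hγ, coeff_neg_adE_of_isRoot hγ', coeff_neg_adE_of_form_nonneg hαγ,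
    coeff_neg_adE_of_form_nonneg hβγ, adE_e_of_form_nonneg hγα₀, adE_e_of_form_nonneg hγβ₀,
    adE_e_of_form_nonneg (hγγ ▸ zero_le_two), coeff_neg_e (α := α) (β := β) (by omega),
    coeff_neg_e (α := β) (β := α) (by rw [form_comm]; omega),
    coeff_neg_e (α := γ) (β := α) (by omega), coeff_neg_e (α := γ) (β := β) (by omega),
    coeff_neg_e (α := γ) (β := γ) (by omega)]
  push_cast
  module

end Commutator

/-! ### Pattern subgroups -/

section Patterns

variable {F : Type*} [Field F] {K P : Set Lat}

theorem x_mem_X {α : Root} (h : α.1 ∈ P) (t : F) : x α t ∈ X F P :=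
  Subgroup.subset_closure ⟨α, t, h, rfl⟩

theorem X_mono (h : K ⊆ P) : X F K ≤ X F P :=
  Subgroup.closure_mono fun _ ⟨α, t, hα, hg⟩ => ⟨α, t, h hα, hg⟩

theorem X_induction {p : ∀ g : LieE6 F ≃ₗ[F] LieE6 F, g ∈ X F P → Prop} (one : p 1 (one_mem _))
    (x_mul : ∀ (α : Root) (t : F) (g) (hα : α.1 ∈ P) (hg : g ∈ X F P), p g hg →
      p (x α t * g) (mul_mem (x_mem_X hα t) hg))
    {g : LieE6 F ≃ₗ[F] LieE6 F} (hg : g ∈ X F P) : p g hg := by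
  induction hg using Subgroup.closure_induction_left with
  | one => exact one
  | mul_left _ h g hg ih =>
    obtain ⟨α, t, hα, rfl⟩ := h
    exact x_mul α t g hα hg ih
  | inv_mul_cancel _ h g hg ih =>
    obtain ⟨α, t, hα, rfl⟩ := h
    simpa only [x_neg] using x_mul α (-t) g hα hg ih

theorem add_ne_zero_of_posRoots {a b : Lat} (ha : a ∈ posRoots) (hb : b ∈ posRoots) :
    a + b ≠ 0 := fun h =>
  not_isRoot_zero (((add_eq_zero_iff_of_nonneg ha.2 hb.2).1 h).1 ▸ ha.1)

theorem add_mem_posRoots {a b : Lat} (ha : a ∈ posRoots) (hb : b ∈ posRoots)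
    (h : IsRoot (a + b)) : a + b ∈ posRoots :=
  ⟨h, add_nonneg ha.2 hb.2⟩

theorem conj_mem_X (hK : IsNormalPattern K P) {α : Root} (hα : α.1 ∈ P) (s : F)
    {g : LieE6 F ≃ₗ[F] LieE6 F} (hg : g ∈ X F K) : x α s * g * (x α s)⁻¹ ∈ X F K := by
  suffices X F K ≤ (X F K).comap (MulAut.conj (x α s)).toMonoidHom from this hg
  refine (Subgroup.closure_le _).2 ?_
  rintro _ ⟨β, t, hβ, rfl⟩
  have hα' := hK.1.1 hα
  have hβ' := hK.2.1.1 hβ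
  change x α s * x β t * (x α s)⁻¹ ∈ X F K
  by_cases h : IsRoot (α.1 + β.1)
  · have hP : α.1 + β.1 ∈ P := hK.1.2 _ hα _ (hK.2.2.1 hβ) (add_mem_posRoots hα' hβ' h)
    have hK' : α.1 + β.1 ∈ K := add_comm β.1 α.1 ▸ hK.2.2.2 _ hβ _ hα (add_comm α.1 β.1 ▸ hP)
    rw [x_mul_x_of_isRoot (γ := ⟨_, h⟩) rfl, mul_inv_cancel_right]
    exact mul_mem (x_mem_X hK' _) (x_mem_X hβ _)
  · rw [x_mul_x_of_not_isRoot (add_ne_zero_of_posRoots hα' hβ') h, mul_inv_cancel_right]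
    exact x_mem_X hβ _

theorem X_le_normalizer (hK : IsNormalPattern K P) :
    X F P ≤ Subgroup.normalizer (X F K : Set (LieE6 F ≃ₗ[F] LieE6 F)) := by
  refine (Subgroup.closure_le _).2 ?_
  rintro _ ⟨α, s, hα, rfl⟩
  refine Subgroup.mem_normalizer_iff.2 fun g => ⟨fun hg => conj_mem_X hK hα s hg, fun hg => ?_⟩
  have := conj_mem_X hK hα (-s) hg
  rw [x_neg] at this
  convert this using 1
  group

theorem XIn_normal (hK : IsNormalPattern K P) : (XIn F P K).Normal :=
  (Subgroup.normal_subgroupOf_iff_le_normalizer (X_mono hK.2.2.1)).2 (X_le_normalizer hK)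

/-- The height of an element of the root lattice. -/
def ht : Lat →+ ℤ := ∑ i, Pi.evalAddMonoidHom _ i

theorem ht_pos {a : Lat} (ha : a ∈ posRoots) : 0 < ht a := by
  rw [ht, AddMonoidHom.finsetSum_apply]
  refine Finset.sum_pos' (fun i _ => ha.2 i) ?_
  by_contra! h
  have : a = 0 := funext fun i => le_antisymm (h i (Finset.mem_univ i)) (ha.2 i)
  exact not_isRoot_zero (this ▸ ha.1)

theorem finite_posRoots : posRoots.Finite := by
  refine (Set.finite_Icc (fun _ => -4 : Lat) (fun _ => 4)).subset fun a ha => ?_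
  have hsum := six_mul_form_self a
  rw [ha.1] at hsum
  have key : ∀ y : ℤ, y ^ 2 ≤ 12 → -4 < y ∧ y < 4 := fun y hy => by
    constructor <;> nlinarith
  have h₁ := key (2 * a 0 - a 2) (by nlinarith)
  have h₂ := key (3 * a 2 - 2 * a 3) (by nlinarith)
  have h₃ := key (2 * a 5 - a 4) (by nlinarith)
  have h₄ := key (3 * a 4 - 2 * a 3) (by nlinarith)
  have h₅ := key (2 * a 1 - a 3) (by nlinarith)
  have h₆ := key (a 3) (by nlinarith)
  constructor <;> intro i <;> fin_cases i <;> simp <;> omega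

variable (F) in
/-- The Borel subalgebra, spanned by the coroots and the root vectors of positive height. -/
def borel : Submodule F (LieE6 F) := ⨅ a ∈ {a | ht a < 0}, LinearMap.ker (coeff a)

theorem mem_borel {v : LieE6 F} : v ∈ borel F ↔ ∀ a, ht a < 0 → coeff a v = 0 := by
  simp [borel]

theorem e_mem_borel {α : Root} (hα : 0 ≤ ht α.1) : (e α : LieE6 F) ∈ borel F :=
  mem_borel.2 fun a ha => by rw [coeff_e, if_neg fun h => by rw [h] at ha; omega]

theorem x_mem_borel_of_mem {α : Root} (hα : α.1 ∈ posRoots) (t : F) {v : LieE6 F}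
    (hv : v ∈ borel F) : x α t v ∈ borel F ∧ (x α t v).1 = v.1 := by
  have hpos := ht_pos hα
  have hneg : coeff (-α.1) v = 0 := mem_borel.1 hv _ (by rw [map_neg]; omega)
  rw [x_apply, hneg, mul_zero, zero_smul, add_zero]
  refine ⟨add_mem hv (Submodule.smul_mem _ _ (mem_borel.2 fun a ha => ?_)), ?_⟩
  · by_cases hr : IsRoot a
    · rw [coeff_adE hr fun h => by rw [h] at ha; omega,
        mem_borel.1 hv (a - α.1) (by rw [map_sub]; omega), mul_zero]
    · exact coeff_of_not_isRoot hr _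
  · ext i
    simp [adE_fst, hneg]

theorem X_mem_borel_of_mem (hP : P ⊆ posRoots) {g : LieE6 F ≃ₗ[F] LieE6 F} (hg : g ∈ X F P)
    {v : LieE6 F} (hv : v ∈ borel F) : g v ∈ borel F ∧ (g v).1 = v.1 := by
  induction hg using X_induction with
  | one => exact ⟨hv, rfl⟩
  | x_mul α t g hα _ ih =>
    have h := x_mem_borel_of_mem (hP hα) t ih.1
    exact ⟨h.1, h.2.trans ih.2⟩

theorem x_e_neg_sub_mem_borel {α β : Root} (hα : α.1 ∈ posRoots) (hle : ht β.1 ≤ ht α.1) (t : F) :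
    x α t (e β.neg) - e β.neg ∈ borel F := by
  have hpos := ht_pos hα
  rw [x_apply, add_assoc, add_sub_cancel_left]
  refine add_mem (Submodule.smul_mem _ _ (mem_borel.2 fun a ha => ?_))
    (Submodule.smul_mem _ _ (e_mem_borel hpos.le))
  by_cases hr : IsRoot a
  · have hne : a - α.1 ≠ β.neg.1 := fun h => by
      have := congrArg ht h
      rw [map_sub, Root.neg, map_neg] at this
      omega
    rw [coeff_adE hr fun h => by rw [h] at ha; omega, coeff_e, if_neg hne, mul_zero]
  · exact coeff_of_not_isRoot hr _

theorem X_e_neg_sub_mem_borel (hP : P ⊆ posRoots) {β : Root} (hβ : ∀ a ∈ P, ht β.1 ≤ ht a)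
    {g : LieE6 F ≃ₗ[F] LieE6 F} (hg : g ∈ X F P) : g (e β.neg) - e β.neg ∈ borel F := by
  induction hg using X_induction with
  | one => simp
  | x_mul α t g hα _ ih =>
    have h₁ := (x_mem_borel_of_mem (hP hα) t ih).1
    have h₂ := x_e_neg_sub_mem_borel (hP hα) (hβ _ hα) t
    rw [map_sub] at h₁
    simpa using add_mem h₁ h₂

/-- The Cartan component of `g e_{-β}`; it detects the factor `x_β(t)` of an element of `X_P` if
`β` is of minimal height in `P`. -/
def leadCoeff (β : Root) (g : LieE6 F ≃ₗ[F] LieE6 F) : Fin 6 → F := (g (e β.neg)).1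

theorem leadCoeff_one (β : Root) : leadCoeff β (1 : LieE6 F ≃ₗ[F] LieE6 F) = 0 := rfl

theorem leadCoeff_x (α β : Root) (t : F) :
    leadCoeff β (x α t) = if α = β then fun i => -(t * (β.1 i : F)) else 0 := by
  ext i
  have h : (-α.1 = β.neg.1) = (α = β) := by simp [Root.neg, Subtype.ext_iff]
  have h0 (γ : Root) : (e γ : LieE6 F).1 = 0 := rfl
  rw [leadCoeff, x_apply]
  simp only [Prod.fst_add, Prod.smul_fst, h0, adE_fst, coeff_e, h]
  split_ifs with hαβ <;> simp [hαβ]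

theorem leadCoeff_mul (hP : P ⊆ posRoots) {β : Root} (hβ : ∀ a ∈ P, ht β.1 ≤ ht a)
    {g g' : LieE6 F ≃ₗ[F] LieE6 F} (hg : g ∈ X F P) (hg' : g' ∈ X F P) :
    leadCoeff β (g * g') = leadCoeff β g + leadCoeff β g' := by
  have h := (X_mem_borel_of_mem hP hg (X_e_neg_sub_mem_borel hP hβ hg')).2
  rw [map_sub, Prod.fst_sub, Prod.fst_sub, show (e β.neg : LieE6 F).1 = 0 from rfl, sub_zero,
    sub_eq_iff_eq_add] at h
  rw [leadCoeff, LinearEquiv.mul_apply, h, add_comm]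
  rfl

theorem leadCoeff_eq_zero (hP : P ⊆ posRoots) {β : Root} (hβ : ∀ a ∈ P, ht β.1 ≤ ht a)
    (hβP : β.1 ∉ P) {g : LieE6 F ≃ₗ[F] LieE6 F} (hg : g ∈ X F P) : leadCoeff β g = 0 := by
  induction hg using X_induction with
  | one => exact leadCoeff_one β
  | x_mul α t g hα hg ih =>
    rw [leadCoeff_mul hP hβ (x_mem_X hα t) hg, ih, leadCoeff_x, add_zero, if_neg]
    rintro rfl
    exact hβP hα

theorem exists_cast_ne_zero {a : Lat} (ha : IsRoot a) : ∃ i, (a i : F) ≠ 0 := by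
  by_contra! h0
  have hF := congrArg (Int.cast : ℤ → F) (dotProduct_self_of_isRoot ha)
  simp [dotProduct, h0] at hF

theorem leadCoeff_x_eq_zero_iff {β : Root} {t : F} : leadCoeff β (x β t) = 0 ↔ t = 0 := by
  refine ⟨fun h => ?_, fun h => by rw [h, x_zero, leadCoeff_one]⟩
  obtain ⟨i, hi⟩ := exists_cast_ne_zero (F := F) β.2
  have := congrFun h i
  rw [leadCoeff_x, if_pos rfl, Pi.zero_apply, neg_eq_zero] at this
  exact (mul_eq_zero.1 this).resolve_right hi

theorem leadCoeff_prod (hP : P ⊆ posRoots) {β : Root} (hβ : ∀ a ∈ P, ht β.1 ≤ ht a)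
    {l : List Root} (hl : l.Nodup) {s : Root → F} (hs : ∀ α ∈ l, α.1 ∉ P → s α = 0) :
    (l.map fun α => x α (s α)).prod ∈ X F P ∧
      leadCoeff β (l.map fun α => x α (s α)).prod =
        if β ∈ l then leadCoeff β (x β (s β)) else 0 := by
  induction l with
  | nil => simp [leadCoeff_one]
  | cons α l ih =>
    obtain ⟨hα, hl⟩ := List.nodup_cons.1 hl
    obtain ⟨ih₁, ih₂⟩ := ih hl fun γ hγ => hs γ (List.mem_cons_of_mem _ hγ)
    have hx : x α (s α) ∈ X F P := by
      by_cases h : α.1 ∈ P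
      · exact x_mem_X h _
      · rw [hs α List.mem_cons_self h, x_zero]
        exact one_mem _
    rw [List.map_cons, List.prod_cons, leadCoeff_mul hP hβ hx ih₁, ih₂]
    refine ⟨mul_mem hx ih₁, ?_⟩
    by_cases h : α = β
    · simp [← h, hα]
    · rw [leadCoeff_x α β, if_neg h, zero_add]
      simp [Ne.symm h]

theorem IsPattern.isNormalPattern_sdiff (hK : IsPattern K) {b : Lat} (hmin : ∀ a ∈ K, ht b ≤ ht a) :
    IsNormalPattern (K \ {b}) K := by
  have key : ∀ a ∈ K, ∀ c ∈ K, a + c ≠ b := fun a ha c hc h => by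
    have h₁ := hmin a ha
    have h₂ := ht_pos (hK.1 hc)
    rw [← h, map_add] at h₁
    omega
  exact ⟨hK, ⟨Set.sdiff_subset.trans hK.1, fun a ha c hc h =>
    ⟨hK.2 a ha.1 c hc.1 h, key a ha.1 c hc.1⟩⟩, Set.sdiff_subset, fun a ha c hc h =>
    ⟨h, key a ha.1 c hc⟩⟩

theorem exists_eq_x_mul (hK : IsPattern K) {β : Root} (hβ : β.1 ∈ K)
    (hmin : ∀ a ∈ K, ht β.1 ≤ ht a) {g : LieE6 F ≃ₗ[F] LieE6 F} (hg : g ∈ X F K) :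
    ∃ t, ∃ u ∈ X F (K \ {β.1}), g = x β t * u := by
  induction hg using X_induction with
  | one => exact ⟨0, 1, one_mem _, by rw [x_zero, one_mul]⟩
  | x_mul α s g hα _ ih =>
    obtain ⟨t, u, hu, rfl⟩ := ih
    by_cases h : α = β
    · exact ⟨s + t, u, hu, by rw [h, x_add, mul_assoc]⟩
    · have hx : x α s ∈ X F (K \ {β.1}) :=
        x_mem_X (P := K \ {β.1}) ⟨hα, fun h' => h (Subtype.ext h')⟩ s
      refine ⟨t, x β (-t) * x α s * (x β (-t))⁻¹ * u,
        mul_mem (conj_mem_X (hK.isNormalPattern_sdiff hmin) hβ _ hx) hu, ?_⟩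
      rw [x_neg]
      group

theorem eq_zero_of_prod_mem_X (hP : IsPattern P) (hK : IsPattern K) (hKP : K ⊆ P) {l : List Root}
    (hl : l.Nodup) {s : Root → F} (hs : ∀ α ∈ l, α.1 ∉ P → s α = 0) (hlK : ∀ α ∈ l, α.1 ∉ K)
    (h : (l.map fun α => x α (s α)).prod ∈ X F K) : ∀ α ∈ l, s α = 0 := by
  induction hn : P.ncard using Nat.strong_induction_on generalizing P K with | _ n ih
  have hfin : P.Finite := finite_posRoots.subset hP.1
  obtain rfl | hne := P.eq_empty_or_nonempty
  · exact fun α hα => hs α hα (Set.notMem_empty _)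
  obtain ⟨b, hb, hmin⟩ := Set.exists_min_image P ht hfin hne
  lift b to Root using (hP.1 hb).1 with β
  have hlt : (P \ {β.1}).ncard < n := hn ▸ Set.ncard_sdiff_singleton_lt_of_mem hb hfin
  have hP' : IsPattern (P \ {β.1}) := (hP.isNormalPattern_sdiff hmin).2.1
  have hlead := (leadCoeff_prod hP.1 hmin hl hs).2
  have hmin' (a : Lat) (ha : a ∈ K) : ht β.1 ≤ ht a := hmin a (hKP ha)
  have hs' (hβ : β ∈ l → s β = 0) (α : Root) (hα : α ∈ l) (hαP : α.1 ∉ P \ {β.1}) : s α = 0 := by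
    by_cases hαβ : α = β
    · exact hαβ ▸ hβ (hαβ ▸ hα)
    · exact hs α hα fun hα' => hαP ⟨hα', fun h' => hαβ (Subtype.ext h')⟩
  by_cases hβ : β.1 ∈ K
  · have hβl : β ∉ l := fun hβ' => hlK β hβ' hβ
    obtain ⟨t, u, hu, heq⟩ := exists_eq_x_mul hK hβ hmin' h
    have hu0 : leadCoeff β u = 0 :=
      leadCoeff_eq_zero (P := K \ {β.1}) (Set.sdiff_subset.trans hK.1) (fun a ha => hmin' a ha.1)
        (fun h => h.2 rfl) hu
    rw [if_neg hβl, heq, leadCoeff_mul hK.1 hmin' (x_mem_X hβ t) (X_mono Set.sdiff_subset hu), hu0,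
      add_zero, leadCoeff_x_eq_zero_iff] at hlead
    rw [hlead, x_zero, one_mul] at heq
    exact ih _ hlt hP' (hK.isNormalPattern_sdiff hmin').2.1 (Set.sdiff_subset_sdiff_left hKP)
      (hs' fun hβ' => absurd hβ' hβl) (fun α hα hα' => hlK α hα hα'.1) (heq ▸ hu) rfl
  · rw [leadCoeff_eq_zero hK.1 hmin' hβ h] at hlead
    refine ih _ hlt hP' hK (Set.subset_sdiff_singleton hKP hβ) (hs' fun hβl => ?_) hlK h rfl
    rw [if_pos hβl] at hlead
    exact leadCoeff_x_eq_zero_iff.1 hlead.symm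

end Patterns

/-! ### Collecting products modulo a central subgroup -/

section Collect

variable {G ι A Z : Type*} [Group G] [AddCommMonoid Z]

/-- The exponent of the central factor that appears when the product of `u i (v i)` and that of
`u i (w i)`, `i ∈ l`, are collected into one ordered product. -/
def collectSum (N : ι → ι → A → A → Z) (v w : ι → A) : List ι → Z
  | [] => 0
  | i :: l => (l.map fun j => N j i (v j) (w i)).sum + collectSum N v w l

variable {u : ι → A → G} {ζ : Z → G} {N : ι → ι → A → A → Z}

theorem prod_map_mul_comm (h0 : ζ 0 = 1) (hadd : ∀ z z', ζ (z + z') = ζ z * ζ z')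
    (hcomm : ∀ z i s, Commute (ζ z) (u i s))
    (hN : ∀ i j s t, u i s * u j t = ζ (N i j s t) * u j t * u i s) (v : ι → A) (i : ι) (t : A)
    (l : List ι) : (l.map fun j => u j (v j)).prod * u i t =
      ζ (l.map fun j => N j i (v j) t).sum * (u i t * (l.map fun j => u j (v j)).prod) := by
  induction l with
  | nil => simp [h0]
  | cons j l ih =>
    simp only [List.map_cons, List.prod_cons, List.sum_cons, hadd]
    rw [mul_assoc, ih, ← mul_assoc, ← (hcomm _ j (v j)).eq, mul_assoc, ← mul_assoc (u j (v j)),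
      hN j i, ← hadd, add_comm, hadd]
    simp only [mul_assoc]

theorem prod_map_mul_prod_map [Add A] (h0 : ζ 0 = 1) (hadd : ∀ z z', ζ (z + z') = ζ z * ζ z')
    (hcomm : ∀ z i s, Commute (ζ z) (u i s)) (hu : ∀ i s t, u i (s + t) = u i s * u i t)
    (hN : ∀ i j s t, u i s * u j t = ζ (N i j s t) * u j t * u i s) (v w : ι → A) (l : List ι) :
    (l.map fun j => u j (v j)).prod * (l.map fun j => u j (w j)).prod =
      ζ (collectSum N v w l) * (l.map fun j => u j (v j + w j)).prod := by
  induction l with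
  | nil => simp [h0, collectSum]
  | cons i l ih =>
    simp only [List.map_cons, List.prod_cons, collectSum, hadd, hu]
    have h1 := prod_map_mul_comm h0 hadd hcomm hN v i (w i) l
    calc u i (v i) * (l.map fun j => u j (v j)).prod * (u i (w i) * (l.map fun j => u j (w j)).prod)
        = u i (v i) * ((l.map fun j => u j (v j)).prod * u i (w i)) *
          (l.map fun j => u j (w j)).prod := by simp only [mul_assoc]
      _ = (u i (v i) * ζ (l.map fun j => N j i (v j) (w i)).sum) * u i (w i) *
          ((l.map fun j => u j (v j)).prod * (l.map fun j => u j (w j)).prod) := by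
        rw [h1]; simp only [mul_assoc]
      _ = ζ (l.map fun j => N j i (v j) (w i)).sum * (u i (v i) *
          (u i (w i) * ζ (collectSum N v w l))) * (l.map fun j => u j (v j + w j)).prod := by
        rw [ih, ← (hcomm _ i (v i)).eq]; simp only [mul_assoc]
      _ = _ := by
        rw [← (hcomm _ i (w i)).eq, ← mul_assoc (u i (v i)), ← (hcomm _ i (v i)).eq]
        simp only [mul_assoc, hu]

end Collect

/-! ### Central extensions defined by bilinear cocycles -/

/-- The central extension of `V` by `Z` with the bilinear cocycle `β`: the group on `V × Z` with
`(v, z) (v', z') = (v + v', z + z' + β v v')`. -/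
@[ext]
structure CentralExt {R V Z : Type*} [CommRing R] [AddCommGroup V] [Module R V] [AddCommGroup Z]
    [Module R Z] (β : V →ₗ[R] V →ₗ[R] Z) where
  /-- The coordinate in the quotient `V`. -/
  v : V
  /-- The coordinate in the central subgroup `Z`. -/
  z : Z

namespace CentralExt

variable {R V Z : Type*} [CommRing R] [AddCommGroup V] [Module R V] [AddCommGroup Z] [Module R Z]
  {β : V →ₗ[R] V →ₗ[R] Z}

instance : One (CentralExt β) := ⟨⟨0, 0⟩⟩
instance : Mul (CentralExt β) := ⟨fun g h => ⟨g.v + h.v, g.z + h.z + β g.v h.v⟩⟩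
instance : Inv (CentralExt β) := ⟨fun g => ⟨-g.v, -g.z + β g.v g.v⟩⟩

@[simp] theorem one_v : (1 : CentralExt β).v = 0 := rfl
@[simp] theorem one_z : (1 : CentralExt β).z = 0 := rfl
@[simp] theorem mul_v (g h : CentralExt β) : (g * h).v = g.v + h.v := rfl
@[simp] theorem mul_z (g h : CentralExt β) : (g * h).z = g.z + h.z + β g.v h.v := rfl
@[simp] theorem inv_v (g : CentralExt β) : g⁻¹.v = -g.v := rfl
@[simp] theorem inv_z (g : CentralExt β) : g⁻¹.z = -g.z + β g.v g.v := rfl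

instance : Group (CentralExt β) :=
  Group.ofLeftAxioms
    (fun a b c => by
      ext1
      · simp only [mul_v, add_assoc]
      · simp only [mul_v, mul_z, map_add, LinearMap.add_apply]
        abel)
    (fun a => by ext1 <;> simp)
    (fun a => by ext1 <;> simp)

theorem commutatorElement_eq (g h : CentralExt β) : ⁅g, h⁆ = ⟨0, β g.v h.v - β h.v g.v⟩ := by
  rw [commutatorElement_def, mul_inv_eq_iff_eq_mul, mul_inv_eq_iff_eq_mul]
  ext1
  · simp [add_comm]
  · simp only [mul_z, mul_v, map_zero, LinearMap.zero_apply, zero_add]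
    abel

variable (β) in
/-- The coordinates `(v, z)` as an equivalence of types. -/
def equivProd : CentralExt β ≃ V × Z where
  toFun g := (g.v, g.z)
  invFun p := ⟨p.1, p.2⟩
  left_inv _ := rfl
  right_inv _ := rfl

instance [Finite V] [Finite Z] : Finite (CentralExt β) := .of_equiv _ (equivProd β).symm

end CentralExt

/-! ### The group of the core -/

/-- The indices of the ten roots of the core outside `Z`. -/
def nIdx : Fin 10 → ℕ := ![1, 4, 6, 7, 9, 10, 11, 13, 14, 19]

/-- The structure constants of the core: `N_{α, β}` if `α + β` is the `k`-th central root, and `0`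
otherwise. -/
def nConst (i j : Fin 10) (k : Fin 6) : ℤ :=
  if root (nIdx i) + root (nIdx j) = root (zIdx k) then sgn (root (nIdx i)) (root (nIdx j)) else 0

section Model

variable {F : Type*} [Field F]

/-- The cocycle of the multiplication of the quattern group of the core, with respect to ordered
products of root elements. -/
def coc : (Fin 10 → F) →ₗ[F] (Fin 10 → F) →ₗ[F] (Fin 6 → F) :=
  LinearMap.mk₂ F
    (fun v w => ![v 3 * w 1 - v 4 * w 0, v 5 * w 2 - v 6 * w 1, -(v 5 * w 3),
      -(v 9 * w 0) - v 8 * w 3, v 8 * w 4 + v 7 * w 5 - v 9 * w 1, v 9 * w 2 + v 7 * w 6])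
    (fun v v' w => by ext k; fin_cases k <;> simp <;> ring)
    (fun c v w => by ext k; fin_cases k <;> simp <;> ring)
    (fun v w w' => by ext k; fin_cases k <;> simp <;> ring)
    (fun c v w => by ext k; fin_cases k <;> simp <;> ring)

theorem coc_apply (v w : Fin 10 → F) :
    coc v w = ![v 3 * w 1 - v 4 * w 0, v 5 * w 2 - v 6 * w 1, -(v 5 * w 3),
      -(v 9 * w 0) - v 8 * w 3, v 8 * w 4 + v 7 * w 5 - v 9 * w 1, v 9 * w 2 + v 7 * w 6] :=
  rfl

variable (F) in
/-- A model of the quattern group of the core, in coordinates. -/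
abbrev Core : Type _ := CentralExt (coc (F := F))

theorem Core.card_eq (F : Type*) [Field F] : Nat.card (Core F) = Nat.card F ^ 16 := by
  rw [Nat.card_congr (CentralExt.equivProd (coc (F := F))), Nat.card_prod, Nat.card_pi,
    Nat.card_pi, Fin.prod_const, Fin.prod_const, ← pow_add]

theorem collectSum_eq_coc (v w : Fin 10 → F) :
    collectSum (fun i j s t k => (nConst i j k : F) * s * t) v w (List.finRange 10) = coc v w := by
  have e : List.finRange 10 = [0, 1, 2, 3, 4, 5, 6, 7, 8, 9] := by decide
  have h0 : ∀ i j : Fin 10, j < i → nConst i j 0 =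
      if i = 3 ∧ j = 1 then 1 else if i = 4 ∧ j = 0 then -1 else 0 := by decide +kernel
  have h1 : ∀ i j : Fin 10, j < i → nConst i j 1 =
      if i = 5 ∧ j = 2 then 1 else if i = 6 ∧ j = 1 then -1 else 0 := by decide +kernel
  have h2 : ∀ i j : Fin 10, j < i → nConst i j 2 =
      if i = 5 ∧ j = 3 then -1 else 0 := by decide +kernel
  have h3 : ∀ i j : Fin 10, j < i → nConst i j 3 =
      if i = 9 ∧ j = 0 then -1 else if i = 8 ∧ j = 3 then -1 else 0 := by decide +kernel
  have h4 : ∀ i j : Fin 10, j < i → nConst i j 4 =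
      if i = 8 ∧ j = 4 then 1 else if i = 7 ∧ j = 5 then 1 else
        if i = 9 ∧ j = 1 then -1 else 0 := by decide +kernel
  have h5 : ∀ i j : Fin 10, j < i → nConst i j 5 =
      if i = 9 ∧ j = 2 then 1 else if i = 7 ∧ j = 6 then 1 else 0 := by decide +kernel
  funext k
  simp only [e, collectSum, List.map_cons, List.map_nil, List.sum_cons, List.sum_nil, Pi.add_apply]
  fin_cases k
  · simp [h0, coc_apply]; ring
  · simp [h1, coc_apply]; ring
  · simp [h2, coc_apply]
  · simp [h3, coc_apply]; ring
  · simp [h4, coc_apply]; ring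
  · simp [h5, coc_apply]

end Model

/-! ### The quattern group of the core -/

section QuatternOfCore

variable {F : Type*} [Field F] {P K : Set Lat} [(XIn F P K).Normal]

theorem xq_root {α : Root} (h : α.1 ∈ P) (t : F) :
    xq P K α.1 t = QuotientGroup.mk ⟨x α t, x_mem_X h t⟩ := by
  rw [xq, dif_pos ⟨α.2, h⟩]

theorem xq_add (α : Lat) (s t : F) : xq P K α (s + t) = xq P K α s * xq P K α t := by
  unfold xq
  split_ifs with h
  · rw [← QuotientGroup.mk_mul]
    congr 1
    exact Subtype.ext (x_add _ s t)
  · rw [mul_one]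

@[simp] theorem xq_zero (α : Lat) : xq P K α (0 : F) = 1 := by
  have h := xq_add (P := P) (K := K) α (0 : F) 0
  rw [add_zero] at h
  exact left_eq_mul.1 h

theorem xq_of_mem {α : Lat} (h : α ∈ K) (t : F) : xq P K α t = 1 := by
  unfold xq
  split_ifs with hα
  · rw [QuotientGroup.eq_one_iff, Subgroup.mem_subgroupOf]
    exact x_mem_X (α := ⟨α, hα.1⟩) h t
  · rfl

theorem xq_of_notMem {α : Lat} (h : α ∉ P) (t : F) : xq P K α t = 1 := by
  rw [xq, dif_neg fun h' => h h'.2]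

theorem xq_of_notMem_diff {α : Lat} (h : α ∉ P \ K) (t : F) : xq P K α t = 1 := by
  by_cases hα : α ∈ P
  · exact xq_of_mem (by_contra fun h' => h ⟨hα, h'⟩) t
  · exact xq_of_notMem hα t

theorem xq_mul_xq (hP : IsPattern P) {α β : Lat} (hα : α ∈ P) (hβ : β ∈ P) (s t : F) :
    xq P K α s * xq P K β t =
      xq P K (α + β) ((sgn α β : F) * s * t) * xq P K β t * xq P K α s := by
  have pα := hP.1 hα
  have pβ := hP.1 hβ
  lift α to Root using pα.1
  lift β to Root using pβ.1
  by_cases h : IsRoot (α.1 + β.1)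
  · have hγ := hP.2 _ hα _ hβ (add_mem_posRoots pα pβ h)
    have e := xq_root (F := F) (K := K) (α := ⟨_, h⟩) hγ ((sgn α.1 β.1 : F) * s * t)
    rw [e, xq_root hα, xq_root hβ, ← QuotientGroup.mk_mul, ← QuotientGroup.mk_mul,
      ← QuotientGroup.mk_mul]
    congr 1
    exact Subtype.ext (x_mul_x_of_isRoot (γ := ⟨_, h⟩) rfl s t)
  · rw [xq, xq, xq, dif_neg (c := IsRoot (α.1 + β.1) ∧ _) fun h' => h h'.1, one_mul,
      dif_pos ⟨α.2, hα⟩, dif_pos ⟨β.2, hβ⟩, ← QuotientGroup.mk_mul, ← QuotientGroup.mk_mul]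
    congr 1
    exact Subtype.ext (x_mul_x_of_not_isRoot (add_ne_zero_of_posRoots pα pβ) h s t)

theorem prod_map_xq {ι : Type*} (r : ι → Root) (hr : ∀ i, (r i).1 ∈ P) (s : ι → F) (l : List ι) :
    ∃ h : (l.map fun i => x (r i) (s i)).prod ∈ X F P,
      (l.map fun i => xq P K (r i).1 (s i)).prod = QuotientGroup.mk ⟨_, h⟩ := by
  induction l with
  | nil => exact ⟨by simp [one_mem], rfl⟩
  | cons i l ih =>
    obtain ⟨h, e⟩ := ih
    refine ⟨by rw [List.map_cons, List.prod_cons]; exact mul_mem (x_mem_X (hr i) _) h, ?_⟩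
    rw [List.map_cons, List.prod_cons, e, xq_root (hr i), ← QuotientGroup.mk_mul]
    rfl

theorem eq_zero_of_prod_map_xq {ι : Type*} (hK : IsNormalPattern K P) {r : ι → Root}
    (hinj : Function.Injective r) (hr : ∀ i, (r i).1 ∈ P \ K) (s : ι → F) {l : List ι}
    (hl : l.Nodup) (h : (l.map fun i => xq P K (r i).1 (s i)).prod = 1) : ∀ i ∈ l, s i = 0 := by
  obtain ⟨hm, e⟩ := prod_map_xq (K := K) r (fun i => (hr i).1) s l
  rw [e, QuotientGroup.eq_one_iff, Subgroup.mem_subgroupOf] at h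
  have e' : (l.map fun i => x (r i) (s i)) =
      (l.map r).map fun α => x α (Function.extend r s 0 α) := by
    simp [hinj.extend_apply]
  change (l.map fun i => x (r i) (s i)).prod ∈ X F K at h
  rw [e'] at h
  have hPK : ∀ α ∈ l.map r, α.1 ∈ P \ K := by
    simp only [List.mem_map, forall_exists_index, and_imp, forall_apply_eq_imp_iff₂]
    exact fun i _ => hr i
  intro i hi
  have hri := eq_zero_of_prod_mem_X hK.1 hK.2.1 hK.2.2.1 (hl.map hinj)
    (fun α hα hαP => absurd (hPK α hα).1 hαP) (fun α hα => (hPK α hα).2) h (r i)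
    (List.mem_map_of_mem hi)
  rwa [hinj.extend_apply] at hri

/-- The roots of the core. -/
def coreRoot : Fin 10 ⊕ Fin 6 → Root :=
  Sum.elim (fun i => ⟨root (nIdx i), by revert i; decide +kernel⟩)
    (fun k => ⟨root (zIdx k), by revert k; decide +kernel⟩)

theorem coreRoot_injective : Function.Injective coreRoot := by
  have : ∀ i j, (coreRoot i).1 = (coreRoot j).1 → i = j := by decide +kernel
  exact fun i j h => this i j (congrArg Subtype.val h)

theorem coreRoot_mem (i : Fin 10 ⊕ Fin 6) : (coreRoot i).1 ∈ coreS := by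
  revert i
  decide +kernel

theorem exists_coreRoot_eq {α : Lat} (h : α ∈ coreS) : ∃ i, (coreRoot i).1 = α := by
  revert α
  decide +kernel

theorem nIdx_add_notMem : ∀ i j, (∀ k, root (nIdx i) + root (nIdx j) ≠ root (zIdx k)) →
    root (nIdx i) + root (nIdx j) ∉ coreS := by
  decide +kernel

theorem zIdx_add_notMem : ∀ k, ∀ α ∈ coreS, root (zIdx k) + α ∉ coreS := by
  decide +kernel

/-- The product of root elements for the central roots. -/
noncomputable def zetaProd (P K : Set Lat) [(XIn F P K).Normal] (z : Fin 6 → F) :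
    QuatternGroup F P K :=
  ((List.finRange 6).map fun k => xq P K (root (zIdx k)) (z k)).prod

/-- The ordered product of root elements for the roots of the core outside `Z`. -/
noncomputable def nProd (P K : Set Lat) [(XIn F P K).Normal] (v : Fin 10 → F) :
    QuatternGroup F P K :=
  ((List.finRange 10).map fun i => xq P K (root (nIdx i)) (v i)).prod

/-- The map from the model to the quattern group. -/
noncomputable def ofCore (P K : Set Lat) [(XIn F P K).Normal] (g : Core F) : QuatternGroup F P K :=
  nProd P K g.v * zetaProd P K g.z

theorem coreS_subset (hS : P \ K = ↑coreS) : (↑coreS : Set Lat) ⊆ P := hS ▸ Set.sdiff_subset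

theorem commute_xq_zIdx (hK : IsNormalPattern K P) (hS : P \ K = ↑coreS) (k : Fin 6)
    (s : F) {α : Lat} (hα : α ∈ coreS) (t : F) :
    Commute (xq P K (root (zIdx k)) s) (xq P K α t) := by
  have h := xq_mul_xq (K := K) hK.1 (coreS_subset hS (coreRoot_mem (.inr k)))
    (coreS_subset hS hα) s t
  have h1 : root (zIdx k) + α ∉ P \ K := hS ▸ zIdx_add_notMem k α hα
  change xq P K (root (zIdx k)) s * _ =
    xq P K (root (zIdx k) + α) _ * _ * xq P K (root (zIdx k)) s at h
  rwa [xq_of_notMem_diff h1, one_mul] at h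

theorem zetaProd_add (hK : IsNormalPattern K P) (hS : P \ K = ↑coreS) (z z' : Fin 6 → F) :
    zetaProd P K (z + z') = zetaProd P K z * zetaProd P K z' := by
  have := prod_map_mul_prod_map (G := QuatternGroup F P K) (Z := ℕ) (ζ := fun _ => 1)
    (u := fun k s => xq P K (root (zIdx k)) s) (N := fun _ _ _ _ => 0) rfl (fun _ _ => by simp)
    (fun _ _ _ => Commute.one_left _) (fun k s t => xq_add _ s t)
    (fun k l s t => by
      rw [one_mul]
      exact commute_xq_zIdx hK hS k s (coreRoot_mem (.inr l)) t) z z' (List.finRange 6)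
  rw [one_mul] at this
  exact this.symm

theorem zetaProd_zero : zetaProd P K (0 : Fin 6 → F) = 1 := by
  simp [zetaProd]

theorem zetaProd_single (k : Fin 6) (t : F) :
    zetaProd P K (Pi.single k t) = xq P K (root (zIdx k)) t := by
  have : List.finRange 6 = [0, 1, 2, 3, 4, 5] := by decide
  rw [zetaProd, this]
  fin_cases k <;> simp [Pi.single_apply]

theorem commute_zetaProd (hK : IsNormalPattern K P) (hS : P \ K = ↑coreS) (z : Fin 6 → F)
    {α : Lat} (hα : α ∈ coreS) (t : F) :
    Commute (zetaProd P K z) (xq P K α t) := by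
  refine Commute.list_prod_left _ _ fun g hg => ?_
  obtain ⟨k, -, rfl⟩ := List.mem_map.1 hg
  exact commute_xq_zIdx hK hS k _ hα t

theorem xq_nIdx_add (hS : P \ K = ↑coreS) (i j : Fin 10) (s t : F) :
    xq P K (root (nIdx i) + root (nIdx j)) ((sgn (root (nIdx i)) (root (nIdx j)) : F) * s * t) =
      zetaProd P K (fun k => (nConst i j k : F) * s * t) := by
  by_cases hk : ∃ k, root (nIdx i) + root (nIdx j) = root (zIdx k)
  · obtain ⟨k, hk⟩ := hk
    rw [hk, ← zetaProd_single]
    congr 1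
    funext k'
    rcases eq_or_ne k' k with rfl | hkk
    · rw [Pi.single_eq_same, nConst, if_pos hk]
    · have : nConst i j k' = 0 := if_neg fun hk' => hkk <| Sum.inr_injective <|
        coreRoot_injective (Subtype.ext (hk'.symm.trans hk))
      simp [this, hkk]
  · have h1 : root (nIdx i) + root (nIdx j) ∉ P \ K :=
      hS ▸ nIdx_add_notMem i j (fun k hk' => hk ⟨k, hk'⟩)
    rw [xq_of_notMem_diff h1, ← zetaProd_zero]
    congr 1
    funext k
    have : nConst i j k = 0 := if_neg fun hk' => hk ⟨k, hk'⟩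
    simp [this]

theorem nProd_mul_nProd (hK : IsNormalPattern K P) (hS : P \ K = ↑coreS) (v w : Fin 10 → F) :
    nProd P K v * nProd P K w = zetaProd P K (coc v w) * nProd P K (v + w) := by
  rw [← collectSum_eq_coc]
  refine prod_map_mul_prod_map (N := fun i j s t k => (nConst i j k : F) * s * t) zetaProd_zero
    (zetaProd_add hK hS) (fun z i s => commute_zetaProd hK hS z (coreRoot_mem (.inl i)) s)
    (fun i s t => xq_add _ s t) (fun i j s t => ?_) v w (List.finRange 10)
  rw [← xq_nIdx_add hS]
  exact xq_mul_xq hK.1 (coreS_subset hS (coreRoot_mem (.inl i)))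
    (coreS_subset hS (coreRoot_mem (.inl j))) s t

theorem ofCore_mul (hK : IsNormalPattern K P) (hS : P \ K = ↑coreS) (g h : Core F) :
    ofCore P K (g * h) = ofCore P K g * ofCore P K h := by
  have hcomm (z : Fin 6 → F) (v : Fin 10 → F) : Commute (zetaProd P K z) (nProd P K v) := by
    refine Commute.list_prod_right _ _ fun g hg => ?_
    obtain ⟨i, -, rfl⟩ := List.mem_map.1 hg
    exact commute_zetaProd hK hS z (coreRoot_mem (.inl i)) _
  calc ofCore P K (g * h)
      = nProd P K (g.v + h.v) * zetaProd P K (coc g.v h.v + (g.z + h.z)) := by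
        rw [ofCore, CentralExt.mul_v, CentralExt.mul_z, add_comm (coc g.v h.v)]
    _ = nProd P K g.v * nProd P K h.v * (zetaProd P K g.z * zetaProd P K h.z) := by
        rw [nProd_mul_nProd hK hS, zetaProd_add hK hS, zetaProd_add hK hS, (hcomm _ _).eq,
          mul_assoc (nProd _ _ _)]
    _ = ofCore P K g * ofCore P K h := ((hcomm g.z h.v).symm.mul_mul_mul_comm _ _)

theorem nProd_zero : nProd P K (0 : Fin 10 → F) = 1 := by
  simp [nProd]

theorem ofCore_z (z : Fin 6 → F) : ofCore P K (⟨0, z⟩ : Core F) = zetaProd P K z := by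
  rw [ofCore, nProd_zero, one_mul]

theorem ofCore_single_z (k : Fin 6) (t : F) :
    ofCore P K (⟨0, Pi.single k t⟩ : Core F) = xq P K (root (zIdx k)) t := by
  rw [ofCore_z, zetaProd_single]

theorem ofCore_single_v (i : Fin 10) (t : F) :
    ofCore P K (⟨Pi.single i t, 0⟩ : Core F) = xq P K (root (nIdx i)) t := by
  have : List.finRange 10 = [0, 1, 2, 3, 4, 5, 6, 7, 8, 9] := by decide
  rw [ofCore, zetaProd_zero, nProd, this]
  fin_cases i <;> simp [Pi.single_apply]

/-- The homomorphism from the model to the quattern group. -/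
noncomputable def coreHom (hK : IsNormalPattern K P) (hS : P \ K = ↑coreS) :
    Core F →* QuatternGroup F P K :=
  MonoidHom.mk' (ofCore P K) (ofCore_mul hK hS)

theorem coreHom_injective (hK : IsNormalPattern K P) (hS : P \ K = ↑coreS) :
    Function.Injective (coreHom (F := F) hK hS) := by
  refine (injective_iff_map_eq_one _).2 fun g hg => ?_
  have h := eq_zero_of_prod_map_xq (K := K) (P := P) hK coreRoot_injective
    (fun i => hS ▸ coreRoot_mem i) (Sum.elim g.v g.z)
    (l := (List.finRange 10).map Sum.inl ++ (List.finRange 6).map Sum.inr) (by decide +kernel) (by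
      rw [List.map_append, List.prod_append, List.map_map, List.map_map]
      exact hg)
  ext i
  · exact h (.inl i) (by simp)
  · exact h (.inr i) (by simp)

theorem coreHom_surjective (hK : IsNormalPattern K P) (hS : P \ K = ↑coreS) :
    Function.Surjective (coreHom (F := F) hK hS) := by
  intro q
  obtain ⟨⟨g, hg⟩, rfl⟩ := QuotientGroup.mk_surjective q
  change QuotientGroup.mk _ ∈ (coreHom (F := F) hK hS).range
  induction hg using Subgroup.closure_induction with
  | mem g hg =>
    obtain ⟨α, t, hα, rfl⟩ := hg
    have e := xq_root (K := K) hα t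
    rw [← e]
    by_cases h : α.1 ∈ P \ K
    · have h' := h
      rw [hS] at h'
      obtain ⟨i | k, hi⟩ := exists_coreRoot_eq h'
      · rw [← hi]
        exact ⟨_, ofCore_single_v i t⟩
      · rw [← hi]
        exact ⟨_, ofCore_single_z k t⟩
    · rw [xq_of_notMem_diff h]
      exact one_mem _
  | one => exact one_mem _
  | mul g g' hg hg' h h' => exact mul_mem h h'
  | inv g hg h => exact inv_mem h

/-- The quattern group of the core is isomorphic to the model. -/
noncomputable def coreEquiv (hK : IsNormalPattern K P) (hS : P \ K = ↑coreS) :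
    Core F ≃* QuatternGroup F P K :=
  MulEquiv.ofBijective (coreHom hK hS) ⟨coreHom_injective hK hS, coreHom_surjective hK hS⟩

theorem coreEquiv_single_z (hK : IsNormalPattern K P) (hS : P \ K = ↑coreS) (k : Fin 6) (t : F) :
    coreEquiv hK hS ⟨0, Pi.single k t⟩ = xq P K (root (zIdx k)) t :=
  ofCore_single_z k t

theorem coreEquiv_single_v (hK : IsNormalPattern K P) (hS : P \ K = ↑coreS) (i : Fin 10) (t : F) :
    coreEquiv hK hS ⟨Pi.single i t, 0⟩ = xq P K (root (nIdx i)) t :=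
  ofCore_single_v i t

end QuatternOfCore

/-! ### Irreducible representations in which commutators act by scalars -/

section Representations

variable {G : Type*} [Group G]

theorem exists_eq_smul_one_of_commute {V : Type*} [AddCommGroup V] [Module ℂ V]
    [FiniteDimensional ℂ V] (ρ : Representation ℂ G V) [ρ.IsIrreducible] (T : Module.End ℂ V)
    (hT : ∀ g, T * ρ g = ρ g * T) : ∃ c : ℂ, T = c • 1 := by
  obtain ⟨c, hc⟩ :=
    (Representation.IsIrreducible.algebraMap_intertwiningMap_bijective_of_isAlgClosed
      (ρ := ρ)).2 ⟨T, hT⟩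
  exact ⟨c, (congrArg Representation.IntertwiningMap.toLinearMap hc).symm⟩

theorem nontrivial_of_isIrreducible {k V : Type*} [Field k] [AddCommGroup V] [Module k V]
    (ρ : Representation k G V) [ρ.IsIrreducible] : Nontrivial V := by
  by_contra h
  rw [not_nontrivial_iff_subsingleton] at h
  exact bot_ne_top (α := Subrepresentation ρ)
    (Subrepresentation.toSubmodule_injective (Subsingleton.elim _ _))

/-- A linear character `μ` of a subgroup `R` of `G` is a *central pair* if `R` contains all the
commutators of `G` and consists of the `g` such that `μ` is trivial on `⁅g, G⁆`. These are the pairs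
`(Z(χ), λ)` with `χ` an irreducible character of degree `n`, whose restriction to `Z(χ)` is `n λ`
and contains the commutators. -/
structure IsCentralPair (R : Subgroup G) (μ : R →* ℂˣ) : Prop where
  commutator_mem : ∀ g h : G, ⁅g, h⁆ ∈ R
  mem_iff : ∀ g : G, g ∈ R ↔ ∀ h : G, μ ⟨⁅g, h⁆, commutator_mem g h⟩ = 1

open Classical in
/-- The multiple `d μ` of a linear character of a subgroup, extended by zero. -/
noncomputable def zeroExt (R : Subgroup G) (d : ℕ) (μ : R →* ℂˣ) (g : G) : ℂ :=
  if h : g ∈ R then d * (μ ⟨g, h⟩ : ℂ) else 0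

section ZeroExt

variable {R : Subgroup G} {d : ℕ} {μ : R →* ℂˣ}

theorem zeroExt_of_mem {g : G} (h : g ∈ R) : zeroExt R d μ g = d * (μ ⟨g, h⟩ : ℂ) := dif_pos h

theorem zeroExt_of_notMem {g : G} (h : g ∉ R) : zeroExt R d μ g = 0 := dif_neg h

theorem zeroExt_one : zeroExt R d μ 1 = d := by
  rw [zeroExt_of_mem (one_mem R), show (⟨1, one_mem R⟩ : R) = 1 from rfl, map_one, Units.val_one,
    mul_one]

theorem zeroExt_mul (r : R) (g : G) : zeroExt R d μ (r * g) = μ r * zeroExt R d μ g := by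
  by_cases hg : g ∈ R
  · have hr : (⟨r * g, mul_mem r.2 hg⟩ : R) = r * ⟨g, hg⟩ := rfl
    rw [zeroExt_of_mem hg, zeroExt_of_mem (mul_mem r.2 hg), hr, map_mul, Units.val_mul]
    ring
  · rw [zeroExt_of_notMem hg, zeroExt_of_notMem ((R.mul_mem_cancel_left r.2).not.2 hg), mul_zero]

theorem zeroExt_injective (hd : d ≠ 0) :
    Function.Injective fun μ : R →* ℂˣ => zeroExt R d μ := by
  intro μ ν h
  ext r
  have hr := congrFun h r
  simp only [zeroExt_of_mem r.2] at hr
  exact mul_left_cancel₀ (Nat.cast_ne_zero.2 hd) hr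

theorem sum_zeroExt_mul_inv [Fintype G] :
    ∑ g, zeroExt R d μ g * zeroExt R d μ g⁻¹ = d ^ 2 * Nat.card R := by
  classical
  have hR : ∀ g, zeroExt R d μ g * zeroExt R d μ g⁻¹ = if g ∈ R then (d : ℂ) ^ 2 else 0 := by
    intro g
    split_ifs with hg
    · have hμ : (μ ⟨g, hg⟩ : ℂ) * μ ⟨g⁻¹, inv_mem hg⟩ = 1 := by
        rw [← Units.val_mul, ← map_mul, ← Units.val_one, ← map_one μ]
        exact congrArg (fun r => (μ r : ℂ)) (Subtype.ext (mul_inv_cancel g))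
      rw [zeroExt_of_mem hg, zeroExt_of_mem (inv_mem hg)]
      linear_combination (d : ℂ) ^ 2 * hμ
    · rw [zeroExt_of_notMem hg, zero_mul]
  simp only [hR]
  rw [← Finset.sum_filter, Finset.sum_const, nsmul_eq_mul, mul_comm, Nat.card_eq_fintype_card,
    Fintype.card_subtype]

end ZeroExt

namespace IsCentralPair

variable {R : Subgroup G} {μ : R →* ℂˣ} (hμ : IsCentralPair R μ)
include hμ

theorem normal : R.Normal :=
  ⟨fun g hg h => by
    have := mul_mem (hμ.commutator_mem h g) hg
    rwa [commutatorElement_def, inv_mul_cancel_right] at this⟩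

theorem map_conj (r : R) (g : G) : μ ⟨g * r * g⁻¹, hμ.normal.conj_mem r r.2 g⟩ = μ r := by
  have hr := (hμ.mem_iff r).1 r.2 g
  have hmul : (⟨⁅(r : G), g⁆, hμ.commutator_mem r g⟩ : R) *
      ⟨g * r * g⁻¹, hμ.normal.conj_mem r r.2 g⟩ = r :=
    Subtype.ext (by simp [commutatorElement_def, mul_assoc])
  rw [← one_mul (μ _), ← hr, ← map_mul, hmul]

theorem eq_zeroExt {f : G → ℂ} (hconj : ∀ g h, f (h * g * h⁻¹) = f g)
    (hmul : ∀ (r : R) g, f (r * g) = μ r * f g) {d : ℕ} (hone : f 1 = d) :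
    f = zeroExt R d μ := by
  funext g
  by_cases hg : g ∈ R
  · rw [zeroExt_of_mem hg, ← hone, mul_comm, ← hmul ⟨g, hg⟩ 1, mul_one]
  rw [zeroExt_of_notMem hg]
  obtain ⟨h, hh⟩ := not_forall.1 (mt (hμ.mem_iff g).2 hg)
  have hf := hmul ⟨⁅g, h⁆, hμ.commutator_mem g h⟩ (h * g * h⁻¹)
  rw [hconj, show ⁅g, h⁆ * (h * g * h⁻¹) = g by simp [commutatorElement_def, mul_assoc]] at hf
  by_contra hfg
  exact hh (Units.ext ((right_eq_mul₀ hfg).1 hf))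

variable {V : Type*} [AddCommGroup V] [Module ℂ V] [FiniteDimensional ℂ V]
  (ρ : Representation ℂ G V) (hρ : ∀ r : R, ρ r = (μ r : ℂ) • 1)
include hρ

theorem character_eq_zeroExt : ρ.character = zeroExt R (Module.finrank ℂ V) μ := by
  refine hμ.eq_zeroExt (fun g h => ρ.char_conj g h) (fun r g => ?_) ρ.char_one
  rw [Representation.character, Representation.character, map_mul, hρ, smul_one_mul, map_smul,
    smul_eq_mul]

theorem sq_finrank_mul_card [Finite G] [ρ.IsIrreducible] :
    Module.finrank ℂ V ^ 2 * Nat.card R = Nat.card G := by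
  have := Fintype.ofFinite G
  have hG : (Nat.card G : ℂ) ≠ 0 := Nat.cast_ne_zero.2 Nat.card_pos.ne'
  have : Invertible (Nat.card G : ℂ) := invertibleOfNonzero hG
  have h := Representation.char_orthonormal ρ ρ
  rw [if_pos ⟨.refl ρ⟩, inv_mul_eq_iff_eq_mul₀ hG, mul_one, hμ.character_eq_zeroExt ρ hρ,
    sum_zeroExt_mul_inv] at h
  exact_mod_cast h

end IsCentralPair

theorem exists_fin_representation {k V : Type*} [Field k] [AddCommGroup V] [Module k V]
    [FiniteDimensional k V] (R : Subgroup G) (μ : R → k) (ρ : Representation k G V)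
    (hρ : ∀ r : R, ρ r = μ r • 1) :
    ∃ σ : Representation k G (Fin (Module.finrank k V) → k), ∀ r : R, σ r = μ r • 1 := by
  let e := (Module.finBasis k V).equivFun
  refine ⟨((e.conjAlgEquiv k : _ ≃ₐ[k] _) : _ →* _).comp ρ, fun r => ?_⟩
  rw [MonoidHom.comp_apply, hρ r]
  exact (map_smul (e.conjAlgEquiv k) (μ r) 1).trans (by rw [map_one])

theorem exists_isIrreducible_of_eq_smul_one {k V : Type*} [Field k] [AddCommGroup V] [Module k V]
    [FiniteDimensional k V] [Nontrivial V] (R : Subgroup G) (μ : R → k)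
    (ρ : Representation k G V) (hρ : ∀ r : R, ρ r = μ r • 1) :
    ∃ (n : ℕ) (σ : Representation k G (Fin n → k)),
      σ.IsIrreducible ∧ ∀ r : R, σ r = μ r • 1 := by
  obtain ⟨σ, hσ⟩ := exists_fin_representation R μ ρ hρ
  have hn : Module.finrank k V ≠ 0 := Module.finrank_pos.ne'
  generalize Module.finrank k V = n at σ hσ hn
  induction n using Nat.strong_induction_on with | _ n ih
  by_cases hirr : σ.IsIrreducible
  · exact ⟨n, σ, hirr, hσ⟩
  have : Nonempty (Fin n) := ⟨⟨0, Nat.pos_of_ne_zero hn⟩⟩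
  have : Nontrivial (Subrepresentation σ) :=
    ⟨⊥, ⊤, fun h => bot_ne_top (congrArg Subrepresentation.toSubmodule h)⟩
  obtain ⟨N, hbot, htop⟩ : ∃ N : Subrepresentation σ, N ≠ ⊥ ∧ N ≠ ⊤ := by
    by_contra! h
    exact hirr ⟨fun N => or_iff_not_imp_left.2 (h N)⟩
  have hlt := Submodule.finrank_lt fun h => htop (Subrepresentation.toSubmodule_injective h)
  rw [Module.finrank_fin_fun] at hlt
  obtain ⟨τ, hτ⟩ := exists_fin_representation R μ N.toRepresentation fun r =>
    LinearMap.ext fun v => Subtype.ext (LinearMap.congr_fun (hσ r) v)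
  exact ih _ hlt τ hτ fun h => hbot (Subrepresentation.toSubmodule_injective
    (Submodule.finrank_eq_zero.1 h))

theorem IsCentralPair.exists_isIrreducible [Finite G] {R : Subgroup G} {μ : R →* ℂˣ}
    (hμ : IsCentralPair R μ) :
    ∃ (n : ℕ) (ρ : Representation ℂ G (Fin n → ℂ)),
      ρ.IsIrreducible ∧ ∀ r : R, ρ r = (μ r : ℂ) • 1 := by
  classical
  let σ : Representation ℂ R ℂ := (Algebra.lmul ℂ ℂ : ℂ →* Module.End ℂ ℂ).comp
    ((Units.coeHom ℂ).comp μ)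
  have hσ : ∀ r z, σ r z = (μ r : ℂ) * z := fun _ _ => rfl
  have hmem : zeroExt R 1 μ ∈ Representation.coindV R.subtype σ := zeroExt_mul
  have : Nontrivial (Representation.coindV R.subtype σ) :=
    ⟨⟨_, hmem⟩, 0, fun h => one_ne_zero
      ((zeroExt_one.trans Nat.cast_one).symm.trans (congrFun (congrArg Subtype.val h) 1))⟩
  refine exists_isIrreducible_of_eq_smul_one R _ (Representation.coind R.subtype σ) fun r => ?_
  ext f y
  have hf := f.2 ⟨y * r * y⁻¹, hμ.normal.conj_mem r r.2 y⟩ y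
  rw [hσ, hμ.map_conj] at hf
  exact (congrArg f.1 (by simp)).trans hf

theorem IsCentralPair.zeroExt_mem_irr [Finite G] {R : Subgroup G} {μ : R →* ℂˣ}
    (hμ : IsCentralPair R μ) {d : ℕ} (hd : d ^ 2 * Nat.card R = Nat.card G) :
    zeroExt R d μ ∈ Irr G := by
  obtain ⟨n, ρ, hirr, hρ⟩ := hμ.exists_isIrreducible
  have hn := hμ.sq_finrank_mul_card ρ hρ
  obtain rfl : d = Module.finrank ℂ (Fin n → ℂ) :=
    Nat.pow_left_injective two_ne_zero (Nat.eq_of_mul_eq_mul_right Nat.card_pos (hd.trans hn.symm))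
  exact ⟨n, ρ, hirr, (hμ.character_eq_zeroExt ρ hρ).symm⟩

/-- The converse of `IsCentralPair.zeroExt_mem_irr` in groups of class two: by Schur's lemma, `R` is
the subgroup of the elements acting by scalars. -/
theorem exists_isCentralPair {V : Type*} [AddCommGroup V] [Module ℂ V] [FiniteDimensional ℂ V]
    (ρ : Representation ℂ G V) [ρ.IsIrreducible]
    (hG : ∀ g h : G, ⁅g, h⁆ ∈ Subgroup.center G) :
    ∃ (R : Subgroup G) (μ : R →* ℂˣ), Subgroup.center G ≤ R ∧ IsCentralPair R μ ∧
      ∀ r : R, ρ r = (μ r : ℂ) • 1 := by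
  have := nontrivial_of_isIrreducible ρ
  let s : ℂˣ →* (Module.End ℂ V)ˣ := Units.map (algebraMap ℂ (Module.End ℂ V))
  have hs : Function.Injective s :=
    Units.map_injective (FaithfulSMul.algebraMap_injective ℂ (Module.End ℂ V))
  let R := s.range.comap ρ.asGroupHom
  let μ : R →* ℂˣ := (MonoidHom.ofInjective hs).symm.toMonoidHom.comp
    (ρ.asGroupHom.subgroupComap s.range)
  have hμ : ∀ r : R, s (μ r) = ρ.asGroupHom r := fun r =>
    congrArg Subtype.val ((MonoidHom.ofInjective hs).apply_symm_apply _)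
  have mem_R : ∀ g, (∀ h, ρ g * ρ h = ρ h * ρ g) → g ∈ R := fun g hg => by
    obtain ⟨c, hc⟩ := exists_eq_smul_one_of_commute ρ (ρ g) hg
    have hc0 : c ≠ 0 := by
      rintro rfl
      exact (ρ.asGroupHom g).ne_zero (hc.trans (zero_smul _ _))
    exact ⟨Units.mk0 c hc0, Units.ext ((Algebra.algebraMap_eq_smul_one c).trans hc.symm)⟩
  have hcenter : Subgroup.center G ≤ R := fun g hg => mem_R g fun h => by
    rw [← map_mul, ← map_mul, Subgroup.mem_center_iff.1 hg h]
  refine ⟨R, μ, hcenter, ⟨fun g h => hcenter (hG g h), fun g => ⟨fun hg h => hs ?_, fun hg =>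
    mem_R g fun h => ?_⟩⟩, fun r => ?_⟩
  · rw [hμ, map_one, map_commutatorElement, commutatorElement_eq_one_iff_mul_comm, ← hμ ⟨g, hg⟩]
    exact Units.ext (Algebra.commutes _ _)
  · have := hμ ⟨⁅g, h⁆, hcenter (hG g h)⟩
    rw [hg, map_one, map_commutatorElement, eq_comm, commutatorElement_eq_one_iff_mul_comm] at this
    exact congrArg Units.val this
  · rw [← Algebra.algebraMap_eq_smul_one]
    exact (congrArg Units.val (hμ r)).symm

theorem exists_isCentralPair_of_mem_irr [Finite G] (hG : ∀ g h : G, ⁅g, h⁆ ∈ Subgroup.center G)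
    {χ : G → ℂ} (hχ : χ ∈ Irr G) :
    ∃ (R : Subgroup G) (μ : R →* ℂˣ) (d : ℕ), Subgroup.center G ≤ R ∧ IsCentralPair R μ ∧ d ≠ 0 ∧
      d ^ 2 * Nat.card R = Nat.card G ∧ χ = zeroExt R d μ := by
  obtain ⟨n, ρ, hρ, rfl⟩ := hχ
  have := nontrivial_of_isIrreducible ρ
  obtain ⟨R, μ, hR, hμ, hμρ⟩ := exists_isCentralPair ρ hG
  exact ⟨R, μ, _, hR, hμ, Module.finrank_pos.ne', hμ.sq_finrank_mul_card ρ hμρ,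
    hμ.character_eq_zeroExt ρ hμρ⟩

section Induction

variable {H : Subgroup G} {ψ : H →* ℂˣ}

theorem indChar_eq_sum [Fintype G] (g : G) :
    indChar H ψ g = (Nat.card H : ℂ)⁻¹ * ∑ y : G, zeroExt H 1 ψ (y⁻¹ * g * y) := by
  simp only [indChar, finsum_eq_sum_of_fintype, zeroExt, Nat.cast_one, one_mul]

theorem indChar_conj [Finite G] (g h : G) : indChar H ψ (h * g * h⁻¹) = indChar H ψ g := by
  have := Fintype.ofFinite G
  rw [indChar_eq_sum, indChar_eq_sum]
  congr 1
  exact Fintype.sum_equiv (Equiv.mulLeft h⁻¹) _ _ fun y => congrArg _ (by simp [mul_assoc])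

theorem indChar_one [Finite G] : indChar H ψ 1 = H.index := by
  have := Fintype.ofFinite G
  have hone : ∀ y : G, zeroExt H 1 ψ (y⁻¹ * 1 * y) = 1 := fun y => by
    rw [mul_one, inv_mul_cancel, zeroExt_one, Nat.cast_one]
  rw [indChar_eq_sum, Finset.sum_congr rfl fun y _ => hone y, Finset.sum_const, nsmul_one,
    Finset.card_univ, ← Nat.card_eq_fintype_card, ← H.card_mul_index, Nat.cast_mul,
    inv_mul_cancel_left₀ (Nat.cast_ne_zero.2 Nat.card_pos.ne')]

theorem IsCentralPair.indChar_eq_zeroExt [Finite G] {R : Subgroup G} {hRH : R ≤ H}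
    (hψ : IsCentralPair R (ψ.comp (Subgroup.inclusion hRH))) :
    indChar H ψ = zeroExt R H.index (ψ.comp (Subgroup.inclusion hRH)) := by
  have := Fintype.ofFinite G
  refine hψ.eq_zeroExt indChar_conj (fun r g => ?_) indChar_one
  rw [indChar_eq_sum, indChar_eq_sum, mul_left_comm]
  congr 1
  rw [Finset.mul_sum]
  refine Finset.sum_congr rfl fun y _ => ?_
  rw [← hψ.map_conj r y⁻¹]
  refine Eq.trans (congrArg _ ?_) (zeroExt_mul _ _)
  simp [mul_assoc]

theorem indChar_apply_mulEquiv [Finite G] {Q : Type*} [Group Q] (e : G ≃* Q) {H' : Subgroup Q}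
    {ψ' : H' →* ℂˣ} (hH : ∀ g, e g ∈ H' ↔ g ∈ H)
    (hψ : ∀ g (hg : g ∈ H), ψ' ⟨e g, (hH g).2 hg⟩ = ψ ⟨g, hg⟩) (g : G) :
    indChar H' ψ' (e g) = indChar H ψ g := by
  have := Fintype.ofFinite G
  have := Fintype.ofEquiv G e.toEquiv
  have hext : ∀ g, zeroExt H' 1 ψ' (e g) = zeroExt H 1 ψ g := fun g => by
    by_cases hg : g ∈ H
    · rw [zeroExt_of_mem hg, zeroExt_of_mem ((hH g).2 hg), hψ g hg]
    · rw [zeroExt_of_notMem hg, zeroExt_of_notMem (mt (hH g).1 hg)]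
  rw [indChar_eq_sum, indChar_eq_sum,
    Nat.card_congr (e.toEquiv.subtypeEquiv fun g => (hH g).symm : H ≃ H')]
  congr 1
  refine (Fintype.sum_equiv e.toEquiv _ _ fun y => ?_).symm
  rw [← hext]
  simp

end Induction

theorem apply_one_ne_zero_of_mem_irr {χ : G → ℂ} (hχ : χ ∈ Irr G) : χ 1 ≠ 0 := by
  obtain ⟨n, ρ, hρ, rfl⟩ := hχ
  have := nontrivial_of_isIrreducible ρ
  rw [ρ.char_one]
  exact Nat.cast_ne_zero.2 Module.finrank_pos.ne'

theorem comp_mem_irr {Q : Type*} [Group Q] (e : G ≃* Q) {χ : Q → ℂ} (hχ : χ ∈ Irr Q) :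
    χ ∘ e ∈ Irr G := by
  obtain ⟨n, ρ, hρ, rfl⟩ := hχ
  refine ⟨n, ρ.comp e.toMonoidHom, ?_, rfl⟩
  let f : Subrepresentation (ρ.comp e.toMonoidHom) ≃o Subrepresentation ρ :=
    { toFun N := ⟨N.toSubmodule, fun q v hv => by
        simpa using N.apply_mem_toSubmodule (e.symm q) hv⟩
      invFun N := ⟨N.toSubmodule, fun g _ hv => N.apply_mem_toSubmodule (e g) hv⟩
      left_inv _ := rfl
      right_inv _ := rfl
      map_rel_iff' := Iff.rfl }
  exact f.isSimpleOrder

theorem comp_mem_irr_iff {Q : Type*} [Group Q] (e : G ≃* Q) {χ : Q → ℂ} :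
    χ ∘ e ∈ Irr G ↔ χ ∈ Irr Q := by
  refine ⟨fun h => ?_, comp_mem_irr e⟩
  simpa [Function.comp_assoc] using comp_mem_irr e.symm h

end Representations

/-! ### Additive characters -/

section AdditiveCharacters

variable (p : ℕ) [Fact p.Prime] {F : Type*} [Field F] [Algebra (ZMod p) F]

variable (F) in
/-- The additive character `φ` of `F`. -/
noncomputable def phiChar : AddChar F ℂ :=
  (ZMod.stdAddChar (N := p)).compAddMonoidHom (Algebra.trace (ZMod p) F).toAddMonoidHom

theorem phi_add (s t : F) : phi p (s + t) = phi p s * phi p t :=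
  (phiChar p F).map_add_eq_mul s t

theorem phi_zero : phi p (0 : F) = 1 :=
  (phiChar p F).map_zero_eq_one

theorem phiChar_isPrimitive [Finite F] : (phiChar p F).IsPrimitive := by
  refine AddChar.IsPrimitive.of_ne_one fun h => ?_
  have : CharP F p := charP_of_injective_algebraMap (algebraMap (ZMod p) F).injective p
  obtain rfl := ringChar.eq F p
  obtain ⟨b, hb⟩ := FiniteField.trace_to_zmod_nondegenerate F (a := 1) one_ne_zero
  rw [one_mul] at hb
  refine hb (ZMod.injective_stdAddChar ?_)
  rw [AddChar.map_zero_eq_one]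
  exact DFunLike.congr_fun h b

theorem eq_zero_of_phi_mul [Finite F] {r : F} (h : ∀ t, phi p (r * t) = 1) : r = 0 :=
  of_not_not fun hr => phiChar_isPrimitive p hr (AddChar.ext _ _ h)

variable {W : Type*} [AddCommGroup W] [Module F W]

theorem dual_eq_zero_of_phi [Finite F] {f : Module.Dual F W} (h : ∀ w, phi p (f w) = 1) :
    f = 0 :=
  LinearMap.ext fun w => eq_zero_of_phi_mul p fun t => by
    rw [mul_comm, ← smul_eq_mul, ← map_smul]
    exact h (t • w)

theorem phiChar_comp_injective [Finite F] : Function.Injective fun f : Module.Dual F W =>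
    (phiChar p F).compAddMonoidHom f.toAddMonoidHom := by
  refine fun f g h => sub_eq_zero.1 (dual_eq_zero_of_phi p fun w => ?_)
  have hw : phi p (f w) = phi p (g w) := DFunLike.congr_fun h w
  exact ((phiChar p F).map_sub_eq_div _ _).trans
    ((div_eq_one_iff_eq ((phiChar p F).val_isUnit _).ne_zero).2 hw)

theorem exists_dual_eq_phi [Finite F] [Finite W] (m : AddChar W ℂ) :
    ∃ f : Module.Dual F W, ∀ w, m w = phi p (f w) := by
  have hcard : Nat.card (AddChar W ℂ) = Nat.card (Module.Dual F W) := by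
    have := Fintype.ofFinite W
    rw [Nat.card_eq_fintype_card, AddChar.card_eq, ← Nat.card_eq_fintype_card]
    exact Nat.card_congr (Module.finBasis F W).toDualEquiv.toEquiv
  obtain ⟨f, hf⟩ := ((phiChar_comp_injective p).bijective_of_nat_card_le hcard.le).2 m
  exact ⟨f, fun w => (DFunLike.congr_fun hf w).symm⟩

end AdditiveCharacters

/-! ### Characters of central extensions -/

namespace CentralExt

section OfSubmodule

variable {R V Z : Type*} [CommRing R] [AddCommGroup V] [Module R V] [AddCommGroup Z] [Module R Z]
  {β : V →ₗ[R] V →ₗ[R] Z}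

theorem mk_add_mem {H : Subgroup (CentralExt β)} (hH : ∀ z, ⟨0, z⟩ ∈ H) {v w : V} {z z' : Z}
    (hv : ⟨v, z⟩ ∈ H) (hw : ⟨w, z'⟩ ∈ H) (z'' : Z) : ⟨v + w, z''⟩ ∈ H := by
  have hmul : (⟨v + w, z''⟩ : CentralExt β) =
      ⟨v, z⟩ * ⟨w, z'⟩ * ⟨0, z'' - (z + z' + β v w)⟩ := by
    ext1 <;> simp
  rw [hmul]
  exact mul_mem (mul_mem hv hw) (hH _)

variable (β) in
/-- The inverse image of a submodule of `V` in the central extension of `V`. -/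
def ofSubmodule (W : Submodule R V) : Subgroup (CentralExt β) where
  carrier := {g | g.v ∈ W}
  one_mem' := W.zero_mem
  mul_mem' := W.add_mem
  inv_mem' := W.neg_mem

theorem mem_ofSubmodule {W : Submodule R V} {g : CentralExt β} :
    g ∈ ofSubmodule β W ↔ g.v ∈ W := Iff.rfl

theorem ofSubmodule_mono {W W' : Submodule R V} (h : W ≤ W') :
    ofSubmodule β W ≤ ofSubmodule β W' := fun _ hg => h hg

theorem mk_zero_mem_ofSubmodule (W : Submodule R V) (z : Z) :
    (⟨0, z⟩ : CentralExt β) ∈ ofSubmodule β W := W.zero_mem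

theorem commutatorElement_mem_ofSubmodule (W : Submodule R V) (g h : CentralExt β) :
    ⁅g, h⁆ ∈ ofSubmodule β W := by
  rw [commutatorElement_eq]
  exact mk_zero_mem_ofSubmodule W _

theorem card_ofSubmodule (W : Submodule R V) :
    Nat.card (ofSubmodule β W) = Nat.card W * Nat.card Z := by
  let e : ofSubmodule β W ≃ W × Z :=
    { toFun g := (⟨g.1.v, g.2⟩, g.1.z)
      invFun y := ⟨⟨y.1, y.2⟩, y.1.2⟩
      left_inv _ := rfl
      right_inv _ := rfl }
  rw [Nat.card_congr e, Nat.card_prod]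

theorem mk_zero_mem_center (z : Z) : (⟨0, z⟩ : CentralExt β) ∈ Subgroup.center (CentralExt β) :=
  Subgroup.mem_center_iff.2 fun g => by ext1 <;> simp [add_comm]

theorem commutatorElement_mem_center (g h : CentralExt β) :
    ⁅g, h⁆ ∈ Subgroup.center (CentralExt β) := by
  rw [commutatorElement_eq]
  exact mk_zero_mem_center _

end OfSubmodule

variable {F V Z : Type*} [Field F] [AddCommGroup V] [Module F V] [AddCommGroup Z] [Module F Z]
  {β : V →ₗ[F] V →ₗ[F] Z}

variable (β) in
/-- The alternating form on `V` obtained by applying `c` to the commutators of the central extension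
with cocycle `β`. -/
def altForm (c : Module.Dual F Z) : V →ₗ[F] V →ₗ[F] F := (β - β.flip).compr₂ c

theorem altForm_apply (c : Module.Dual F Z) (v w : V) :
    altForm β c v w = c (β v w - β w v) := rfl

variable (β) in
/-- The subgroup of the elements which are central modulo the kernel of `c : Z → F`. -/
def radGroup (c : Module.Dual F Z) : Subgroup (CentralExt β) :=
  ofSubmodule β (LinearMap.ker (altForm β c))

variable (p : ℕ) [Fact p.Prime] [Algebra (ZMod p) F]

/-- The linear character `μ` extends the character `φ ∘ c` of the central subgroup `Z`. -/
def ExtendsPhi (c : Module.Dual F Z) {H : Subgroup (CentralExt β)} (μ : H →* ℂˣ) : Prop :=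
  ∀ (z : Z) (h : ⟨0, z⟩ ∈ H), (μ ⟨⟨0, z⟩, h⟩ : ℂ) = phi p (c z)

variable (β) in
/-- The irreducible characters with central character `φ ∘ c` on `Z`. -/
def irrOver (c : Module.Dual F Z) : Set (CentralExt β → ℂ) :=
  {χ | χ ∈ Irr (CentralExt β) ∧ ∀ z, χ ⟨0, z⟩ = χ 1 * phi p (c z)}

variable {p} {c : Module.Dual F Z}

theorem ExtendsPhi.mem_radGroup_iff [Finite F] {H : Subgroup (CentralExt β)} {μ : H →* ℂˣ}
    (hμ : ExtendsPhi p c μ) (hH : ∀ g h : CentralExt β, ⁅g, h⁆ ∈ H) (g : CentralExt β) :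
    g ∈ radGroup β c ↔ ∀ h, μ ⟨⁅g, h⁆, hH g h⟩ = 1 := by
  have hcomm : ∀ h, (μ ⟨⁅g, h⁆, hH g h⟩ : ℂ) = phi p (altForm β c g.v h.v) := fun h => by
    simp only [commutatorElement_eq]
    exact hμ _ _
  refine ⟨fun hg h => Units.ext ?_, fun hg => dual_eq_zero_of_phi p fun w => ?_⟩
  · rw [hcomm, LinearMap.mem_ker.1 (mem_ofSubmodule.1 hg), LinearMap.zero_apply, phi_zero,
      Units.val_one]
  · rw [← hcomm ⟨w, 0⟩, hg, Units.val_one]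

theorem ExtendsPhi.isCentralPair [Finite F] {μ : radGroup β c →* ℂˣ} (hμ : ExtendsPhi p c μ) :
    IsCentralPair (radGroup β c) μ where
  commutator_mem := commutatorElement_mem_ofSubmodule _
  mem_iff := hμ.mem_radGroup_iff (commutatorElement_mem_ofSubmodule _)

theorem eq_radGroup [Finite F] {H : Subgroup (CentralExt β)} {μ : H →* ℂˣ}
    (hH : IsCentralPair H μ) (hμ : ExtendsPhi p c μ) : H = radGroup β c :=
  SetLike.ext fun g => (hH.mem_iff g).trans (hμ.mem_radGroup_iff hH.commutator_mem g).symm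

theorem extendsPhi_iff_zeroExt {H : Subgroup (CentralExt β)} {μ : H →* ℂˣ} {d : ℕ} (hd : d ≠ 0)
    (hH : ∀ z, ⟨0, z⟩ ∈ H) :
    ExtendsPhi p c μ ↔ ∀ z, zeroExt H d μ ⟨0, z⟩ = zeroExt H d μ 1 * phi p (c z) := by
  refine forall_congr' fun z => ?_
  rw [zeroExt_one, zeroExt_of_mem (hH z), mul_right_inj' (Nat.cast_ne_zero.2 hd)]
  exact forall_prop_of_true (hH z)

theorem bijOn_zeroExt [Finite F] [Finite V] [Finite Z] {d : ℕ}
    (hd : d ^ 2 * Nat.card (radGroup β c) = Nat.card (CentralExt β)) :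
    Set.BijOn (zeroExt (radGroup β c) d) {μ | ExtendsPhi p c μ} (irrOver β p c) := by
  have hd0 : d ≠ 0 := by
    rintro rfl
    rw [zero_pow two_ne_zero, zero_mul] at hd
    exact Nat.card_pos.ne hd
  refine ⟨fun μ hμ => ⟨hμ.isCentralPair.zeroExt_mem_irr hd,
    (extendsPhi_iff_zeroExt hd0 (mk_zero_mem_ofSubmodule _)).1 hμ⟩,
    (zeroExt_injective hd0).injOn, fun χ hχ => ?_⟩
  obtain ⟨R, μ, n, hR, hRμ, hn, hnR, rfl⟩ :=
    exists_isCentralPair_of_mem_irr commutatorElement_mem_center hχ.1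
  have hμ := (extendsPhi_iff_zeroExt hn fun z => hR (mk_zero_mem_center z)).2 hχ.2
  obtain rfl := eq_radGroup hRμ hμ
  obtain rfl : n = d := Nat.pow_left_injective two_ne_zero
    (Nat.eq_of_mul_eq_mul_right Nat.card_pos (hnR.trans hd.symm))
  exact ⟨μ, hμ, rfl⟩

theorem exists_extendsPhi [Finite F] [Finite Z] {H : Subgroup (CentralExt β)}
    (hH : ∀ z, ⟨0, z⟩ ∈ H) (μ : H →* ℂˣ) : ∃ c : Module.Dual F Z, ExtendsPhi p c μ := by
  let m : AddChar Z ℂ :=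
    { toFun z := μ ⟨⟨0, z⟩, hH z⟩
      map_zero_eq_one' := Units.val_eq_one.2 (map_one μ)
      map_add_eq_mul' z z' := by
        rw [← Units.val_mul, ← map_mul]
        exact congrArg (fun h => (μ h : ℂ)) (Subtype.ext (by ext1 <;> simp)) }
  obtain ⟨c, hc⟩ := exists_dual_eq_phi (F := F) p m
  exact ⟨c, fun z _ => hc z⟩

theorem exists_mem_irrOver [Finite F] [Finite V] [Finite Z] {χ : CentralExt β → ℂ}
    (hχ : χ ∈ Irr (CentralExt β)) : ∃ c : Module.Dual F Z, χ ∈ irrOver β p c := by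
  obtain ⟨R, μ, n, hR, -, hn, -, rfl⟩ :=
    exists_isCentralPair_of_mem_irr commutatorElement_mem_center hχ
  have hRz : ∀ z, ⟨0, z⟩ ∈ R := fun z => hR (mk_zero_mem_center z)
  obtain ⟨c, hc⟩ := exists_extendsPhi (p := p) hRz μ
  exact ⟨c, hχ, (extendsPhi_iff_zeroExt hn hRz).1 hc⟩

theorem eq_of_mem_irrOver [Finite F] {c' : Module.Dual F Z} {χ : CentralExt β → ℂ}
    (hχ : χ ∈ irrOver β p c) (hχ' : χ ∈ irrOver β p c') : c = c' :=
  phiChar_comp_injective p (AddChar.ext _ _ fun z =>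
    mul_left_cancel₀ (apply_one_ne_zero_of_mem_irr hχ.1) ((hχ.2 z).symm.trans (hχ'.2 z)))

section LinChar

variable {W : Submodule F V}

/-- A function `Q` on `W` which polarizes to `- c ∘ β`. Such functions correspond to the linear
characters `(v, z) ↦ φ (c z + Q v)` of the inverse image of `W`. -/
def IsPolar (β : V →ₗ[F] V →ₗ[F] Z) (c : Module.Dual F Z) (Q : W → F) : Prop :=
  ∀ v w : W, Q (v + w) + c (β v w) = Q v + Q w

theorem IsPolar.map_zero {Q : W → F} (hQ : IsPolar β c Q) : Q 0 = 0 := by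
  simpa using hQ 0 0

theorem IsPolar.add_dual {Q : W → F} (hQ : IsPolar β c Q) (f : Module.Dual F W) :
    IsPolar β c (Q + ⇑f) := fun v w => by
  simp only [Pi.add_apply, map_add]
  linear_combination hQ v w

variable (p)

/-- The linear character `(v, z) ↦ φ (c z + Q v)` of the inverse image of `W`. -/
noncomputable def linChar {Q : W → F} (hQ : IsPolar β c Q) : ofSubmodule β W →* ℂˣ :=
  MonoidHom.toHomUnits
    { toFun g := phi p (c g.1.z + Q ⟨g.1.v, g.2⟩)
      map_one' := (congrArg (phi p) ((congrArg₂ (· + ·) (map_zero c) hQ.map_zero).trans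
        (add_zero 0))).trans (phi_zero p)
      map_mul' g h := by
        rw [← phi_add]
        congr 1
        have hgh : Q ⟨g.1.v + h.1.v, _⟩ + _ = _ := hQ ⟨g.1.v, g.2⟩ ⟨h.1.v, h.2⟩
        simp only [Subgroup.coe_mul, mul_z, mul_v, map_add]
        linear_combination hgh }

theorem linChar_apply {Q : W → F} (hQ : IsPolar β c Q) (g : ofSubmodule β W) :
    (linChar p hQ g : ℂ) = phi p (c g.1.z + Q ⟨g.1.v, g.2⟩) := rfl

theorem extendsPhi_linChar {Q : W → F} (hQ : IsPolar β c Q) : ExtendsPhi p c (linChar p hQ) :=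
  fun z _ => congrArg (phi p) ((congrArg (c z + ·) hQ.map_zero).trans (add_zero _))

theorem linChar_add_dual_apply {Q : W → F} (hQ : IsPolar β c Q) (f : Module.Dual F W)
    (g : ofSubmodule β W) :
    (linChar p (hQ.add_dual f) g : ℂ) = linChar p hQ g * phi p (f ⟨g.1.v, g.2⟩) := by
  rw [linChar_apply, linChar_apply, ← phi_add, Pi.add_apply, add_assoc]

variable {p}

theorem ExtendsPhi.exists_dual [Finite F] [Finite W] {ν : ofSubmodule β W →* ℂˣ}
    (hν : ExtendsPhi p 0 ν) :
    ∃ f : Module.Dual F W, ∀ g : ofSubmodule β W, (ν g : ℂ) = phi p (f ⟨g.1.v, g.2⟩) := by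
  have hz : ∀ (w : W) z, (ν ⟨⟨w, z⟩, w.2⟩ : ℂ) = ν ⟨⟨w, 0⟩, w.2⟩ := fun w z => by
    have hwz : (⟨⟨w, z⟩, w.2⟩ : ofSubmodule β W) =
        ⟨⟨w, 0⟩, w.2⟩ * ⟨⟨0, z⟩, mk_zero_mem_ofSubmodule W z⟩ :=
      Subtype.ext (by ext1 <;> simp)
    rw [hwz, map_mul, Units.val_mul, hν, LinearMap.zero_apply, phi_zero, mul_one]
  let m : AddChar W ℂ :=
    { toFun w := ν ⟨⟨w, 0⟩, w.2⟩
      map_zero_eq_one' := Units.val_eq_one.2 (map_one ν)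
      map_add_eq_mul' w w' := by
        rw [← Units.val_mul, ← map_mul, ← hz _ (0 + 0 + β w w')]
        rfl }
  obtain ⟨f, hf⟩ := exists_dual_eq_phi (F := F) p m
  exact ⟨f, fun g => (hz ⟨g.1.v, g.2⟩ g.1.z).trans (hf _)⟩

variable (p)

theorem bijOn_linChar [Finite F] [Finite W] {Q : W → F} (hQ : IsPolar β c Q) :
    Set.BijOn (fun f : Module.Dual F W => linChar p (hQ.add_dual f)) Set.univ
      {μ | ExtendsPhi p c μ} := by
  refine ⟨fun f _ => extendsPhi_linChar p _, fun f _ f' _ h => ?_, fun μ hμ => ?_⟩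
  · refine phiChar_comp_injective p (AddChar.ext _ _ fun w => ?_)
    have hl : linChar p (hQ.add_dual f) = linChar p (hQ.add_dual f') := h
    have hw := linChar_add_dual_apply p hQ f ⟨⟨w, 0⟩, w.2⟩
    rw [hl, linChar_add_dual_apply p hQ] at hw
    exact (mul_left_cancel₀ (Units.ne_zero _) hw).symm
  · have hν : ExtendsPhi p 0 (μ / linChar p hQ) := fun z h => by
      rw [MonoidHom.div_apply, Units.val_div_eq_div_val, hμ, extendsPhi_linChar p hQ,
        LinearMap.zero_apply, phi_zero]
      exact div_self ((phiChar p F).val_isUnit _).ne_zero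
    obtain ⟨f, hf⟩ := hν.exists_dual
    refine ⟨f, trivial, MonoidHom.ext fun g => Units.ext ?_⟩
    rw [linChar_add_dual_apply p hQ, ← hf, ← Units.val_mul, MonoidHom.div_apply, mul_div_cancel]

end LinChar

variable (p)

section Polarization

variable {W : Submodule F V} {Q : W → F}

/-- In characteristic `3`, the factor `-1/2` of the polarization identity is equal to `1`. -/
theorem isPolar_self (h3 : (3 : F) = 0) (hW : ∀ v ∈ W, ∀ w ∈ W, altForm β c v w = 0) :
    IsPolar β c fun v : W => c (β v v) := fun v w => by
  have hvw := hW v v.2 w w.2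
  rw [altForm_apply, map_sub] at hvw
  simp only [Submodule.coe_add, map_add, LinearMap.add_apply]
  linear_combination c (β v w) * h3 - hvw

theorem IsPolar.comp_inclusion (hQ : IsPolar β c Q) {W' : Submodule F V} (h : W' ≤ W) :
    IsPolar β c (Q ∘ Submodule.inclusion h) := fun v w =>
  hQ (Submodule.inclusion h v) (Submodule.inclusion h w)

theorem indChar_linChar [Finite F] [Finite V] [Finite Z]
    (hW : LinearMap.ker (altForm β c) ≤ W) (hQ : IsPolar β c Q) :
    indChar (ofSubmodule β W) (linChar p hQ) =
      zeroExt (radGroup β c) (ofSubmodule β W).index (linChar p (hQ.comp_inclusion hW)) :=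
  IsCentralPair.indChar_eq_zeroExt (hRH := ofSubmodule_mono hW)
    (extendsPhi_linChar p (hQ.comp_inclusion hW)).isCentralPair

theorem bijOn_indChar_linChar [Finite F] [Finite V] [Finite Z]
    (hW : LinearMap.ker (altForm β c) ≤ W) (hQ : IsPolar β c Q)
    (hd : (ofSubmodule β W).index ^ 2 * Nat.card (radGroup β c) = Nat.card (CentralExt β))
    {ι : Type*} {f : ι → Module.Dual F W}
    (hf : Function.Bijective fun i => f i ∘ₗ Submodule.inclusion hW) :
    Set.BijOn (fun i => indChar (ofSubmodule β W) (linChar p (hQ.add_dual (f i)))) Set.univ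
      (irrOver β p c) := by
  have hL : ∀ i, linChar p ((hQ.add_dual (f i)).comp_inclusion hW) =
      linChar p ((hQ.comp_inclusion hW).add_dual (f i ∘ₗ Submodule.inclusion hW)) := fun i =>
    MonoidHom.ext fun g => Units.ext rfl
  simp only [indChar_linChar p hW, hL]
  exact (bijOn_zeroExt hd).comp ((bijOn_linChar p (hQ.comp_inclusion hW)).comp hf.bijOn_univ)

theorem existsUnique_mem_irrOver [Finite F] [Finite V] [Finite Z]
    (hker : LinearMap.ker (altForm β c) = ⊥) {d : ℕ}
    (hd : d ^ 2 * Nat.card (radGroup β c) = Nat.card (CentralExt β)) :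
    ∃! χ, χ ∈ irrOver β p c := by
  have hsub : Subsingleton (LinearMap.ker (altForm β c)) := by
    rw [hker]
    infer_instance
  have hQ : IsPolar β c (0 : LinearMap.ker (altForm β c) → F) := fun v w => by
    simp [Subsingleton.elim v 0]
  have hbij := (bijOn_zeroExt hd).comp (bijOn_linChar p hQ)
  refine ⟨_, hbij.mapsTo (Set.mem_univ 0), fun χ hχ => ?_⟩
  obtain ⟨f, -, rfl⟩ := hbij.surjOn hχ
  rw [Subsingleton.elim f 0]

theorem apply_one_of_mem_irrOver [Finite F] [Finite V] [Finite Z] {d : ℕ}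
    (hd : d ^ 2 * Nat.card (radGroup β c) = Nat.card (CentralExt β)) {χ : CentralExt β → ℂ}
    (hχ : χ ∈ irrOver β p c) : χ 1 = d := by
  obtain ⟨μ, -, rfl⟩ := (bijOn_zeroExt hd).surjOn hχ
  exact zeroExt_one

end Polarization
end CentralExt

/-! ### The radical and a maximal isotropic subspace -/

section Radical

variable {F : Type*} [Field F] {a : Fin 6 → F} {v : Fin 10 → F}

/-- The radical of the alternating form which belongs to the character `z ↦ φ (a ⬝ᵥ z)` of the
centre. -/
abbrev coreRadical (a : Fin 6 → F) : Submodule F (Fin 10 → F) :=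
  LinearMap.ker (CentralExt.altForm coc (dotProductEquiv F (Fin 6) a))

theorem altForm_coc_apply (a : Fin 6 → F) (v w : Fin 10 → F) :
    CentralExt.altForm coc (dotProductEquiv F (Fin 6) a) v w =
      ![-(a 0 * v 4 + a 3 * v 9), a 0 * v 3 - a 1 * v 6 - a 4 * v 9, a 1 * v 5 + a 5 * v 9,
        -(a 0 * v 1 + a 2 * v 5 + a 3 * v 8), a 0 * v 0 + a 4 * v 8,
        a 2 * v 3 + a 4 * v 7 - a 1 * v 2, a 1 * v 1 + a 5 * v 7, -(a 4 * v 5 + a 5 * v 6),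
        a 3 * v 3 - a 4 * v 4, a 3 * v 0 + a 4 * v 1 - a 5 * v 2] ⬝ᵥ w := by
  simp [CentralExt.altForm_apply, coc_apply, dotProduct, Fin.sum_univ_succ]
  ring

theorem mem_coreRadical : v ∈ coreRadical a ↔
    (a 0 * v 4 + a 3 * v 9 = 0 ∧ a 0 * v 3 - a 1 * v 6 - a 4 * v 9 = 0 ∧
      a 1 * v 5 + a 5 * v 9 = 0 ∧ a 0 * v 1 + a 2 * v 5 + a 3 * v 8 = 0 ∧
      a 0 * v 0 + a 4 * v 8 = 0) ∧
    (a 2 * v 3 + a 4 * v 7 - a 1 * v 2 = 0 ∧ a 1 * v 1 + a 5 * v 7 = 0 ∧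
      a 4 * v 5 + a 5 * v 6 = 0 ∧ a 3 * v 3 - a 4 * v 4 = 0 ∧
      a 3 * v 0 + a 4 * v 1 - a 5 * v 2 = 0) := by
  simp only [LinearMap.mem_ker, LinearMap.ext_iff, altForm_coc_apply, LinearMap.zero_apply,
    dotProduct_eq_zero_iff]
  simp [funext_iff, Fin.forall_fin_succ, and_assoc, -neg_add_rev, neg_eq_zero]

theorem coreRadical_eq_bot (h3 : (3 : F) ≠ 0) (ha : ∀ k, a k ≠ 0) : coreRadical a = ⊥ := by
  refine (Submodule.eq_bot_iff _).2 fun v hv => ?_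
  obtain ⟨⟨e0, e1, e2, e3, e4⟩, e5, e6, e7, e8, e9⟩ := mem_coreRadical.1 hv
  have cancel : ∀ k (y : F), a k * y = 0 → y = 0 := fun k y hy =>
    (mul_eq_zero.1 hy).resolve_left (ha k)
  have cancel3 : ∀ y : F, 3 * y = 0 → y = 0 := fun y hy => (mul_eq_zero.1 hy).resolve_left h3
  have v9 : v 9 = 0 := cancel 3 _ (cancel 4 _ (cancel 5 _ (cancel3 _ (by
    linear_combination -a 3 * a 5 * e1 + a 0 * a 5 * e8 + a 4 * a 5 * e0 - a 1 * a 3 * e7 +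
      a 3 * a 4 * e2))))
  have v4 : v 4 = 0 := cancel 0 _ (by linear_combination e0 - a 3 * v9)
  have v5 : v 5 = 0 := cancel 1 _ (by linear_combination e2 - a 5 * v9)
  have v6 : v 6 = 0 := cancel 5 _ (by linear_combination e7 - a 4 * v5)
  have v3 : v 3 = 0 := cancel 3 _ (by linear_combination e8 + a 4 * v4)
  have v1 : v 1 = 0 := cancel 0 _ (cancel 1 _ (cancel 4 _ (cancel3 _ (by
    linear_combination a 0 * a 1 * e9 - a 1 * a 3 * e4 + a 1 * a 4 * e3 - a 0 * a 5 * e5 +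
      a 0 * a 4 * e6 - a 1 * a 2 * a 4 * v5 + a 0 * a 2 * a 5 * v3))))
  have v7 : v 7 = 0 := cancel 5 _ (by linear_combination e6 - a 1 * v1)
  have v8 : v 8 = 0 := cancel 3 _ (by linear_combination e3 - a 0 * v1 - a 2 * v5)
  have v0 : v 0 = 0 := cancel 0 _ (by linear_combination e4 - a 4 * v8)
  have v2 : v 2 = 0 := cancel 1 _ (by linear_combination -e5 + a 2 * v3 + a 4 * v7)
  funext i
  fin_cases i <;> assumption

end Radical

section Isotropic

variable {F : Type*} [Field F]

/-- The vector of `x_{1,6,7,14}(t) x_{4,6,7,13}(s) x_9(j₀) x_{10}(j₁) x_{11}(j₂) x_{19}(j₃)`, modulo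
the centre. -/
def isoVec (a : Fin 6 → F) : F × F × (Fin 4 → F) →ₗ[F] (Fin 10 → F) where
  toFun y := ![a 2 * a 4 * a 5 * y.1, a 2 * a 5 * y.2.1, a 2 * a 3 * a 4 * y.1 + a 2 * a 4 * y.2.1,
    a 1 * a 3 * a 4 * y.1 + 2 * a 1 * a 4 * y.2.1, y.2.2 0, y.2.2 1, y.2.2 2,
    -(a 1 * a 2 * y.2.1), -(a 0 * a 2 * a 5 * y.1), y.2.2 3]
  map_add' y y' := by
    ext i
    fin_cases i <;> simp <;> ring
  map_smul' r y := by
    ext i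
    fin_cases i <;> simp <;> ring

theorem isoVec_apply (a : Fin 6 → F) (t s : F) (j : Fin 4 → F) : isoVec a (t, s, j) =
    ![a 2 * a 4 * a 5 * t, a 2 * a 5 * s, a 2 * a 3 * a 4 * t + a 2 * a 4 * s,
      a 1 * a 3 * a 4 * t + 2 * a 1 * a 4 * s, j 0, j 1, j 2, -(a 1 * a 2 * s),
      -(a 0 * a 2 * a 5 * t), j 3] := rfl

/-- The vectors of the label subgroup; in characteristic `3`, they are a maximal isotropic
subspace. -/
abbrev isoSpace (a : Fin 6 → F) : Submodule F (Fin 10 → F) := LinearMap.range (isoVec a)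

/-- The coordinates `j` of the vectors `isoVec a (t, s, j)` in the radical, in characteristic
`3`. -/
def radEmb (a : Fin 6 → F) : F × F →ₗ[F] F × F × (Fin 4 → F) where
  toFun y := (y.1, y.2, ![a 1 * a 3 ^ 2 * y.1 - a 1 * a 3 * y.2,
    a 0 * a 3 * a 5 * y.1 - a 0 * a 5 * y.2, a 0 * a 4 * y.2 - a 0 * a 3 * a 4 * y.1,
    a 0 * a 1 * y.2 - a 0 * a 1 * a 3 * y.1])
  map_add' y y' := by
    ext i
    · rfl
    · rfl
    · fin_cases i <;> simp <;> ring
  map_smul' r y := by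
    ext i
    · rfl
    · rfl
    · fin_cases i <;> simp <;> ring

theorem radEmb_apply (a : Fin 6 → F) (t s : F) : radEmb a (t, s) = (t, s,
    ![a 1 * a 3 ^ 2 * t - a 1 * a 3 * s, a 0 * a 3 * a 5 * t - a 0 * a 5 * s,
      a 0 * a 4 * s - a 0 * a 3 * a 4 * t, a 0 * a 1 * s - a 0 * a 1 * a 3 * t]) := rfl

theorem altForm_isoVec (h3 : (3 : F) = 0) (a : Fin 6 → F) :
    ∀ v ∈ isoSpace a, ∀ w ∈ isoSpace a,
      CentralExt.altForm coc (dotProductEquiv F (Fin 6) a) v w = 0 := by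
  rintro _ ⟨⟨t, s, j⟩, rfl⟩ _ ⟨⟨t', s', j'⟩, rfl⟩
  rw [altForm_coc_apply]
  simp [isoVec_apply, dotProduct, Fin.sum_univ_succ]
  linear_combination (a 0 * a 1 * a 2 * a 3 * a 4 * a 5 * (t * s' - s * t')) * h3

variable {a : Fin 6 → F} (ha : ∀ k, a k ≠ 0)
include ha

theorem isoVec_injective : Function.Injective (isoVec a) := by
  rintro ⟨t, s, j⟩ ⟨t', s', j'⟩ h
  have hi := congrFun h
  simp only [isoVec_apply] at hi
  have ht : t = t' := by simpa [ha] using hi 0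
  have hs : s = s' := by simpa [ha] using hi 1
  have hj : j = j' := funext fun i => by
    fin_cases i
    exacts [hi 4, hi 5, hi 6, hi 9]
  rw [ht, hs, hj]

theorem coreRadical_le_range (h3 : (3 : F) = 0) :
    coreRadical a ≤ LinearMap.range (isoVec a ∘ₗ radEmb a) := by
  intro v hv
  obtain ⟨⟨e0, -, e2, e3, e4⟩, e5, e6, e7, e8, -⟩ := mem_coreRadical.1 hv
  have cancel : ∀ k (y z : F), a k * y = a k * z → y = z := fun k y z hy =>
    mul_left_cancel₀ (ha k) hy
  have h2 := ha 2
  have h4 := ha 4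
  have h5 := ha 5
  obtain ⟨t, v0⟩ : ∃ t, v 0 = a 2 * a 4 * a 5 * t := ⟨v 0 / (a 2 * a 4 * a 5), by field_simp⟩
  obtain ⟨s, v1⟩ : ∃ s, v 1 = a 2 * a 5 * s := ⟨v 1 / (a 2 * a 5), by field_simp⟩
  have v8 : v 8 = -(a 0 * a 2 * a 5 * t) := cancel 4 _ _ (by linear_combination e4 - a 0 * v0)
  have v5 : v 5 = a 0 * a 3 * a 5 * t - a 0 * a 5 * s :=
    cancel 2 _ _ (by linear_combination e3 - a 0 * v1 - a 3 * v8)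
  have v9 : v 9 = a 0 * a 1 * s - a 0 * a 1 * a 3 * t :=
    cancel 5 _ _ (by linear_combination e2 - a 1 * v5)
  have v4 : v 4 = a 1 * a 3 ^ 2 * t - a 1 * a 3 * s :=
    cancel 0 _ _ (by linear_combination e0 - a 3 * v9)
  have v3 : v 3 = a 1 * a 3 * a 4 * t + 2 * a 1 * a 4 * s :=
    cancel 3 _ _ (by linear_combination e8 + a 4 * v4 - a 1 * a 3 * a 4 * s * h3)
  have v6 : v 6 = a 0 * a 4 * s - a 0 * a 3 * a 4 * t :=
    cancel 5 _ _ (by linear_combination e7 - a 4 * v5)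
  have v7 : v 7 = -(a 1 * a 2 * s) := cancel 5 _ _ (by linear_combination e6 - a 1 * v1)
  have v2 : v 2 = a 2 * a 3 * a 4 * t + a 2 * a 4 * s :=
    cancel 1 _ _ (by linear_combination -e5 + a 2 * v3 + a 4 * v7)
  refine ⟨(t, s), funext fun i => ?_⟩
  fin_cases i
  exacts [v0.symm, v1.symm, v2.symm, v3.symm, v4.symm, v5.symm, v6.symm, v7.symm, v8.symm,
    v9.symm]

theorem coreRadical_eq_range (h3 : (3 : F) = 0) :
    coreRadical a = LinearMap.range (isoVec a ∘ₗ radEmb a) := by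
  refine le_antisymm (coreRadical_le_range ha h3) ?_
  rintro _ ⟨⟨t, s⟩, rfl⟩
  rw [mem_coreRadical]
  simp only [LinearMap.comp_apply, radEmb_apply, isoVec_apply, Matrix.cons_val]
  refine ⟨⟨?_, ?_, ?_, ?_, ?_⟩, ?_, ?_, ?_, ?_, ?_⟩
  · ring
  · linear_combination a 0 * a 1 * a 3 * a 4 * t * h3
  · ring
  · ring
  · ring
  · ring
  · ring
  · ring
  · linear_combination a 1 * a 3 * a 4 * s * h3
  · ring

theorem coreRadical_le_isoSpace (h3 : (3 : F) = 0) : coreRadical a ≤ isoSpace a :=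
  (coreRadical_eq_range ha h3).trans_le (LinearMap.range_comp_le_range _ _)

/-- The linear form `b₁ t + b₂ s` in the coordinates `(t, s, j)` of `isoSpace a`. -/
noncomputable def labelDual (b : F × F) : Module.Dual F (isoSpace a) :=
  (b.1 • LinearMap.fst F F (F × (Fin 4 → F)) +
    b.2 • LinearMap.fst F F (Fin 4 → F) ∘ₗ LinearMap.snd F F (F × (Fin 4 → F))) ∘ₗ
      (LinearEquiv.ofInjective (isoVec a) (isoVec_injective ha)).symm

theorem labelDual_isoVec (b : F × F) (t s : F) (j : Fin 4 → F) :
    labelDual ha b ⟨isoVec a (t, s, j), LinearMap.mem_range_self _ _⟩ = b.1 * t + b.2 * s := by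
  have hsymm : (LinearEquiv.ofInjective (isoVec a) (isoVec_injective ha)).symm
      ⟨isoVec a (t, s, j), LinearMap.mem_range_self _ _⟩ = (t, s, j) :=
    (LinearEquiv.symm_apply_eq _).2 rfl
  simp [labelDual, hsymm]

theorem bijective_labelDual (h3 : (3 : F) = 0) : Function.Bijective fun b =>
    labelDual ha b ∘ₗ Submodule.inclusion (coreRadical_le_isoSpace ha h3) := by
  let r : F × F →ₗ[F] coreRadical a := (isoVec a ∘ₗ radEmb a).codRestrict _ fun y =>
    (coreRadical_eq_range ha h3).ge (LinearMap.mem_range_self _ y)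
  have hr : ∀ v, ∃ t s, r (t, s) = v := fun v => by
    obtain ⟨⟨t, s⟩, hts⟩ := coreRadical_le_range ha h3 v.2
    exact ⟨t, s, Subtype.ext hts⟩
  have hdual : ∀ (b : F × F) t s, labelDual ha b (Submodule.inclusion
      (coreRadical_le_isoSpace ha h3) (r (t, s))) = b.1 * t + b.2 * s := fun b t s =>
    labelDual_isoVec ha b t s _
  refine ⟨fun b b' h => ?_, fun f => ?_⟩
  · have hb : ∀ t s, b.1 * t + b.2 * s = b'.1 * t + b'.2 * s := fun t s => by
      rw [← hdual, ← hdual]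
      exact LinearMap.congr_fun h (r (t, s))
    exact Prod.ext (by simpa using hb 1 0) (by simpa using hb 0 1)
  · refine ⟨(f (r (1, 0)), f (r (0, 1))), LinearMap.ext fun v => ?_⟩
    obtain ⟨t, s, rfl⟩ := hr v
    have hts : ((t, s) : F × F) = t • (1, 0) + s • (0, 1) := by simp
    rw [LinearMap.comp_apply, hdual, hts, map_add, map_add, map_smul, map_smul, map_smul,
      map_smul, smul_eq_mul, smul_eq_mul, mul_comm t, mul_comm s]

open CentralExt

theorem card_radGroup_of_three_ne_zero (h3 : (3 : F) ≠ 0) :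
    (Nat.card F ^ 5) ^ 2 * Nat.card (radGroup coc (dotProductEquiv F (Fin 6) a)) =
      Nat.card (Core F) := by
  have hcard : Nat.card (coreRadical a) = 1 := by
    rw [coreRadical_eq_bot h3 ha, Nat.card_unique]
  rw [radGroup, card_ofSubmodule, hcard, Core.card_eq, Nat.card_pi,
    Fin.prod_const]
  ring

theorem index_ofSubmodule_isoSpace [Finite F] :
    (ofSubmodule coc (isoSpace a)).index = Nat.card F ^ 4 := by
  have hcard : Nat.card (isoSpace a) = Nat.card F ^ 6 := by
    rw [← Nat.card_congr (LinearEquiv.ofInjective _ (isoVec_injective ha)).toEquiv]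
    simp only [Nat.card_prod, Nat.card_pi, Fin.prod_const]
    ring
  have hmul := (ofSubmodule coc (isoSpace a)).card_mul_index
  rw [card_ofSubmodule, hcard, Core.card_eq, Nat.card_pi,
    Fin.prod_const] at hmul
  refine Nat.eq_of_mul_eq_mul_left (pow_pos (Nat.card_pos (α := F)) 12) ?_
  rw [← pow_add, ← hmul]
  ring

theorem card_radGroup_of_three_eq_zero (h3 : (3 : F) = 0) :
    (Nat.card F ^ 4) ^ 2 * Nat.card (radGroup coc (dotProductEquiv F (Fin 6) a)) =
      Nat.card (Core F) := by
  have hemb : Function.Injective (radEmb a) := fun y y' h => by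
    have h1 := congrArg Prod.fst h
    have h2 := congrArg (fun z => z.2.1) h
    exact Prod.ext h1 h2
  have hinj : Function.Injective (isoVec a ∘ₗ radEmb a) := (isoVec_injective ha).comp hemb
  have hcard : Nat.card (coreRadical a) = Nat.card F ^ 2 := by
    rw [coreRadical_eq_range ha h3, ← Nat.card_congr (LinearEquiv.ofInjective _ hinj).toEquiv]
    rw [Nat.card_prod, sq]
  rw [radGroup, card_ofSubmodule, hcard, Core.card_eq, Nat.card_pi,
    Fin.prod_const]
  ring

end Isotropic

/-! ### The label subgroup -/

open CentralExt

section LabelSubgroup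

variable {F : Type*} [Field F] {P K : Set Lat} [(XIn F P K).Normal]

/-- The element of the model corresponding to `x_{1,6,7,14}(t)`. -/
def modelX1 (a : Fin 6 → F) (t : F) : Core F :=
  ⟨isoVec a (t, 0, 0), Pi.single 3 (a 0 * a 1 * a 2 * a 3 * a 4 * a 5 * t ^ 2 / 2)⟩

/-- The element of the model corresponding to `x_{4,6,7,13}(t)`. -/
def modelX2 (a : Fin 6 → F) (t : F) : Core F :=
  ⟨isoVec a (0, t, 0), Pi.single 0 (a 1 * a 2 * a 4 * a 5 * t ^ 2)⟩

theorem single_eq_isoVec (a : Fin 6 → F) (i : Fin 4) (t : F) :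
    (Pi.single ((![4, 5, 6, 9] : Fin 4 → Fin 10) i) t : Fin 10 → F) =
      isoVec a (0, 0, Pi.single i t) := by
  funext k
  fin_cases i <;> fin_cases k <;> simp [isoVec_apply]

theorem nIdx_mem (i : Fin 4) :
    nIdx ((![4, 5, 6, 9] : Fin 4 → Fin 10) i) ∈ ({9, 10, 11, 19} : Finset ℕ) := by
  revert i
  decide

theorem exists_eq_nIdx {j : ℕ} (hj : j ∈ ({9, 10, 11, 19} : Finset ℕ)) :
    ∃ i : Fin 4, j = nIdx ((![4, 5, 6, 9] : Fin 4 → Fin 10) i) := by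
  revert j
  decide

variable (hK : IsNormalPattern K P) (hS : P \ K = ↑coreS) (a : Fin 6 → Fˣ)
include hK hS

theorem coreEquiv_modelX1 (t : F) :
    coreEquiv hK hS (modelX1 (fun k => (a k : F)) t) = x1' P K a t := by
  have h1 := coreEquiv_single_v (F := F) hK hS 0
  have h6 := coreEquiv_single_v (F := F) hK hS 2
  have h7 := coreEquiv_single_v (F := F) hK hS 3
  have h14 := coreEquiv_single_v (F := F) hK hS 8
  have h22 := coreEquiv_single_z (F := F) hK hS 3
  simp only [nIdx, zIdx, Matrix.cons_val] at h1 h6 h7 h14 h22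
  simp only [x1', ← h1, ← h6, ← h7, ← h14, ← h22, ← map_mul]
  congr 1
  ext i
  · fin_cases i <;> simp [modelX1, isoVec_apply]
  · fin_cases i <;> simp [modelX1, coc_apply, Matrix.vecHead, Matrix.vecTail]

theorem coreEquiv_modelX2 (t : F) :
    coreEquiv hK hS (modelX2 (fun k => (a k : F)) t) = x2' P K a t := by
  have h4 := coreEquiv_single_v (F := F) hK hS 1
  have h6 := coreEquiv_single_v (F := F) hK hS 2
  have h7 := coreEquiv_single_v (F := F) hK hS 3
  have h13 := coreEquiv_single_v (F := F) hK hS 7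
  have h12 := coreEquiv_single_z (F := F) hK hS 0
  simp only [nIdx, zIdx, Matrix.cons_val] at h4 h6 h7 h13 h12
  simp only [x2', ← h4, ← h6, ← h7, ← h13, ← h12, ← map_mul]
  congr 1
  ext i
  · fin_cases i <;> simp [modelX2, isoVec_apply]
  · fin_cases i <;> simp [modelX2, coc_apply, Matrix.vecHead, Matrix.vecTail]

theorem labelSubgroup_le_map : labelSubgroup P K a ≤
    (ofSubmodule coc (isoSpace fun k => (a k : F))).map (coreEquiv hK hS).toMonoidHom := by
  refine (Subgroup.closure_le _).2 ?_
  rintro g (((⟨t, rfl⟩ | ⟨t, rfl⟩) | ⟨j, hj, t, rfl⟩) | ⟨k, t, rfl⟩)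
  · exact ⟨_, ⟨(t, 0, 0), rfl⟩, coreEquiv_modelX1 hK hS a t⟩
  · exact ⟨_, ⟨(0, t, 0), rfl⟩, coreEquiv_modelX2 hK hS a t⟩
  · obtain ⟨i, rfl⟩ := exists_eq_nIdx hj
    exact ⟨_, ⟨_, (single_eq_isoVec _ i t).symm⟩, coreEquiv_single_v hK hS _ t⟩
  · exact ⟨_, mk_zero_mem_ofSubmodule _ _, coreEquiv_single_z hK hS k t⟩

theorem coreEquiv_mk_zero_mem_labelSubgroup (z : Fin 6 → F) :
    coreEquiv hK hS ⟨0, z⟩ ∈ labelSubgroup P K a := by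
  have hz : coreEquiv hK hS ⟨0, z⟩ = zetaProd P K z := ofCore_z z
  rw [hz]
  refine Subgroup.list_prod_mem _ fun y hy => ?_
  obtain ⟨k, -, rfl⟩ := List.mem_map.1 hy
  exact Subgroup.subset_closure (.inr ⟨k, z k, rfl⟩)

theorem coreEquiv_isoVec_mem_labelSubgroup (y : F × F × (Fin 4 → F)) (z : Fin 6 → F) :
    coreEquiv hK hS ⟨isoVec (fun k => (a k : F)) y, z⟩ ∈ labelSubgroup P K a := by
  obtain ⟨t, s, j⟩ := y
  let H : Subgroup (Core F) := (labelSubgroup P K a).comap (coreEquiv hK hS).toMonoidHom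
  have hH : ∀ z, ⟨0, z⟩ ∈ H := coreEquiv_mk_zero_mem_labelSubgroup hK hS a
  have ht : modelX1 (fun k => (a k : F)) t ∈ H :=
    Subgroup.subset_closure (.inl (.inl (.inl ⟨t, coreEquiv_modelX1 hK hS a t⟩)))
  have hs : modelX2 (fun k => (a k : F)) s ∈ H :=
    Subgroup.subset_closure (.inl (.inl (.inr ⟨s, coreEquiv_modelX2 hK hS a s⟩)))
  have hj : ⟨isoVec (fun k => (a k : F)) (0, 0, j), 0⟩ ∈ H := by
    induction j using Pi.single_induction with
    | zero => exact map_zero (isoVec fun k => (a k : F)) ▸ hH 0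
    | add j j' hj hj' =>
      have hadd : ((0, 0, j + j') : F × F × (Fin 4 → F)) = (0, 0, j) + (0, 0, j') := by simp
      rw [hadd, map_add]
      exact mk_add_mem hH hj hj' 0
    | single i r =>
      rw [← single_eq_isoVec]
      exact Subgroup.subset_closure
        (.inl (.inr ⟨_, nIdx_mem i, r, coreEquiv_single_v hK hS _ r⟩))
  have htsj : ((t, s, j) : F × F × (Fin 4 → F)) = (t, 0, 0) + (0, s, 0) + (0, 0, j) := by simp
  rw [htsj, map_add, map_add]
  exact mk_add_mem hH (mk_add_mem hH ht hs 0) hj z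

theorem coreEquiv_mem_labelSubgroup_iff {g : Core F} :
    coreEquiv hK hS g ∈ labelSubgroup P K a ↔
      g ∈ ofSubmodule coc (isoSpace fun k => (a k : F)) := by
  refine ⟨fun hg => ?_, fun ⟨y, hy⟩ => ?_⟩
  · obtain ⟨h, hh, he⟩ := labelSubgroup_le_map hK hS a hg
    rwa [← (coreEquiv hK hS).injective he]
  · have hg := coreEquiv_isoVec_mem_labelSubgroup hK hS a y g.z
    rwa [hy] at hg

end LabelSubgroup

section LabelChar

variable (p : ℕ) [Fact p.Prime] {F : Type*} [Field F] [Algebra (ZMod p) F]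

/-- The linear form `z ↦ a ⬝ᵥ z` on the centre with the label `a`. -/
abbrev coreDual (a : Fin 6 → Fˣ) : Module.Dual F (Fin 6 → F) :=
  dotProductEquiv F (Fin 6) fun k => (a k : F)

variable (h3 : (3 : F) = 0) (a : Fin 6 → Fˣ) (b : F × F)

/-- The linear character with label `(a, b)`, as a character of a subgroup of the model. -/
noncomputable def modelLabelChar : ofSubmodule coc (isoSpace fun k => (a k : F)) →* ℂˣ :=
  linChar p (c := coreDual a) ((isPolar_self h3 (altForm_isoVec h3 _)).add_dual
    (labelDual (fun k => (a k).ne_zero) b))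

variable {p a}

theorem modelLabelChar_apply (t s : F) (j : Fin 4 → F) (z : Fin 6 → F) {h} :
    (modelLabelChar p h3 a b ⟨⟨isoVec (fun k => (a k : F)) (t, s, j), z⟩, h⟩ : ℂ) =
      phi p (coreDual a z + (coreDual a (coc (isoVec (fun k => (a k : F)) (t, s, j))
        (isoVec (fun k => (a k : F)) (t, s, j))) + (b.1 * t + b.2 * s))) := by
  rw [← labelDual_isoVec (fun k => (a k).ne_zero) b t s j]
  rfl

theorem modelLabelChar_mk_zero (z : Fin 6 → F) {h} :
    (modelLabelChar p h3 a b ⟨⟨0, z⟩, h⟩ : ℂ) = phi p (coreDual a z) :=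
  extendsPhi_linChar p _ z h

theorem modelLabelChar_modelX1 (t : F) {h} :
    (modelLabelChar p h3 a b ⟨modelX1 (fun k => (a k : F)) t, h⟩ : ℂ) = phi p (b.1 * t) := by
  have h2 : (2 : F)⁻¹ = -1 := by
    have h : (2 : F) = -1 := by linear_combination h3
    rw [h, inv_neg, inv_one]
  refine (modelLabelChar_apply h3 b t 0 0 _).trans (congrArg (phi p) ?_)
  simp [isoVec_apply, coc_apply, dotProduct, Fin.sum_univ_succ, div_eq_mul_inv, h2]
  ring

theorem modelLabelChar_modelX2 (t : F) {h} :
    (modelLabelChar p h3 a b ⟨modelX2 (fun k => (a k : F)) t, h⟩ : ℂ) = phi p (b.2 * t) := by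
  refine (modelLabelChar_apply h3 b 0 t 0 _).trans (congrArg (phi p) ?_)
  simp [isoVec_apply, coc_apply, dotProduct, Fin.sum_univ_succ]
  linear_combination (a 0 * a 1 * a 2 * a 4 * a 5 * t ^ 2 : F) * h3

theorem modelLabelChar_single (i : Fin 4) (t : F) {h} :
    (modelLabelChar p h3 a b
      ⟨⟨Pi.single ((![4, 5, 6, 9] : Fin 4 → Fin 10) i) t, 0⟩, h⟩ : ℂ) = 1 := by
  revert h
  rw [single_eq_isoVec fun k => (a k : F)]
  intro h
  rw [modelLabelChar_apply, ← phi_zero p (F := F)]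
  congr 1
  simp [isoVec_apply, coc_apply, dotProduct, Fin.sum_univ_succ]

variable {P K : Set Lat} [(XIn F P K).Normal] (hK : IsNormalPattern K P) (hS : P \ K = ↑coreS)
variable (p a)

/-- The linear character with label `(a, b)` of the label subgroup. -/
noncomputable def labelChar : labelSubgroup P K a →* ℂˣ :=
  (modelLabelChar p h3 a b).comp
    (((coreEquiv hK hS).symm.toMonoidHom.comp (labelSubgroup P K a).subtype).codRestrict _
      fun h => (coreEquiv_mem_labelSubgroup_iff hK hS a).1 (by simp))

variable {p a}

theorem labelChar_coreEquiv {g : Core F} (h : coreEquiv hK hS g ∈ labelSubgroup P K a) :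
    labelChar p h3 a b hK hS ⟨coreEquiv hK hS g, h⟩ =
      modelLabelChar p h3 a b ⟨g, (coreEquiv_mem_labelSubgroup_iff hK hS a).1 h⟩ :=
  congrArg (modelLabelChar p h3 a b) (Subtype.ext ((coreEquiv hK hS).symm_apply_apply g))

theorem isLabelChar_labelChar : IsLabelChar p a b (labelChar p h3 a b hK hS) := by
  rintro ⟨h, hh⟩ t
  obtain ⟨g, rfl⟩ := (coreEquiv hK hS).surjective h
  rw [labelChar_coreEquiv]
  refine ⟨fun e => ?_, fun e => ?_, fun j hj e => ?_, fun k e => ?_⟩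
  · obtain rfl := (coreEquiv hK hS).injective (e.trans (coreEquiv_modelX1 hK hS a t).symm)
    exact modelLabelChar_modelX1 h3 b t
  · obtain rfl := (coreEquiv hK hS).injective (e.trans (coreEquiv_modelX2 hK hS a t).symm)
    exact modelLabelChar_modelX2 h3 b t
  · obtain ⟨i, rfl⟩ := exists_eq_nIdx hj
    obtain rfl := (coreEquiv hK hS).injective (e.trans (coreEquiv_single_v hK hS _ t).symm)
    exact modelLabelChar_single h3 b i t
  · obtain rfl := (coreEquiv hK hS).injective (e.trans (coreEquiv_single_z hK hS k t).symm)
    rw [modelLabelChar_mk_zero]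
    simp

theorem indChar_labelChar_comp_coreEquiv [Finite F] :
    indChar (labelSubgroup P K a) (labelChar p h3 a b hK hS) ∘ coreEquiv hK hS =
      indChar (ofSubmodule coc (isoSpace fun k => (a k : F))) (modelLabelChar p h3 a b) :=
  funext <| indChar_apply_mulEquiv _ (fun _ => coreEquiv_mem_labelSubgroup_iff hK hS a)
    fun _ _ => labelChar_coreEquiv h3 b hK hS _

end LabelChar

/-! ### Parametrization of the characters with central root support `Z` -/

section Parametrization

variable (p : ℕ) [Fact p.Prime] {F : Type*} [Field F] [Algebra (ZMod p) F]
  {P K : Set Lat} [(XIn F P K).Normal] (hK : IsNormalPattern K P) (hS : P \ K = ↑coreS)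

variable {p hK hS} in
theorem apply_xq_zIdx {χ : QuatternGroup F P K → ℂ} {a : Fin 6 → F}
    (hχ : χ ∘ coreEquiv hK hS ∈ irrOver coc p (dotProductEquiv F (Fin 6) a)) (k : Fin 6) (t : F) :
    χ (xq P K (root (zIdx k)) t) = χ 1 * phi p (a k * t) := by
  have h := hχ.2 (Pi.single k t)
  simpa only [Function.comp_apply, map_one, coreEquiv_single_z, dotProductEquiv_apply_apply,
    dotProduct_single] using h

variable {p hK hS} in
theorem range_xq_subset_charKer_iff [Finite F] {χ : QuatternGroup F P K → ℂ} {a : Fin 6 → F}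
    (hχ : χ ∘ coreEquiv hK hS ∈ irrOver coc p (dotProductEquiv F (Fin 6) a)) (k : Fin 6) :
    Set.range (fun t : F => xq P K (root (zIdx k)) t) ⊆ charKer χ ↔ a k = 0 := by
  have hχ1 : χ 1 ≠ 0 := apply_one_ne_zero_of_mem_irr ((comp_mem_irr_iff _).1 hχ.1)
  simp only [Set.range_subset_iff, charKer, Set.mem_ofPred_eq, apply_xq_zIdx hχ,
    mul_eq_left₀ hχ1]
  exact ⟨eq_zero_of_phi_mul p, fun hk t => by rw [hk, zero_mul, phi_zero]⟩

theorem mem_irrSupp_iff [Finite F] {χ : QuatternGroup F P K → ℂ} :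
    χ ∈ IrrSupp F P K ↑coreZ ↔
      ∃ a : Fin 6 → Fˣ, χ ∘ coreEquiv hK hS ∈ irrOver coc p (coreDual a) := by
  have hZ : χ ∈ IrrSupp F P K ↑coreZ ↔ χ ∈ Irr (QuatternGroup F P K) ∧
      ∀ k, ¬ Set.range (fun t : F => xq P K (root (zIdx k)) t) ⊆ charKer χ := by
    simp [IrrSupp, coreZ]
  rw [hZ]
  refine ⟨fun ⟨hχ, hker⟩ => ?_, fun ⟨a, hχ⟩ => ⟨(comp_mem_irr_iff _).1 hχ.1, fun k hk => ?_⟩⟩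
  · obtain ⟨c, hc⟩ := exists_mem_irrOver (p := p) ((comp_mem_irr_iff (coreEquiv hK hS)).2 hχ)
    obtain ⟨a, rfl⟩ := (dotProductEquiv F (Fin 6)).surjective c
    exact ⟨fun k => Units.mk0 (a k) fun hk => hker k ((range_xq_subset_charKer_iff hc k).2 hk), hc⟩
  · exact (a k).ne_zero ((range_xq_subset_charKer_iff hχ k).1 hk)

theorem coreDual_injective : Function.Injective (coreDual (F := F)) := fun _ _ h =>
  funext fun k => Units.ext (congrFun ((dotProductEquiv F (Fin 6)).injective h) k)

variable {p hK hS}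

theorem bijOn_irrSupp [Finite F] {J : Type*} {π : J → Fin 6 → Fˣ}
    {χ : J → QuatternGroup F P K → ℂ}
    (h : ∀ a, Set.BijOn (fun i => χ i ∘ coreEquiv hK hS) (π ⁻¹' {a}) (irrOver coc p (coreDual a))) :
    Set.BijOn χ Set.univ (IrrSupp F P K ↑coreZ) := by
  have hmem : ∀ i, χ i ∘ coreEquiv hK hS ∈ irrOver coc p (coreDual (π i)) := fun i =>
    (h (π i)).mapsTo rfl
  refine ⟨fun i _ => (mem_irrSupp_iff p hK hS).2 ⟨π i, hmem i⟩, fun i _ j _ hij => ?_,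
    fun χ' hχ' => ?_⟩
  · have hπ : π i = π j := coreDual_injective (eq_of_mem_irrOver (hmem i) (hij ▸ hmem j))
    exact (h (π j)).injOn hπ rfl (congrArg (· ∘ coreEquiv hK hS) hij)
  · obtain ⟨a, ha⟩ := (mem_irrSupp_iff p hK hS).1 hχ'
    obtain ⟨i, -, hi⟩ := (h a).surjOn ha
    exact ⟨i, trivial, (coreEquiv hK hS).surjective.injective_comp_right hi⟩

variable (p hK hS)

include p hK hS in
theorem apply_one_of_mem_irrSupp [Finite F] {d : ℕ} (hd : ∀ a : Fin 6 → Fˣ,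
      d ^ 2 * Nat.card (radGroup coc (coreDual a)) = Nat.card (Core F))
    {χ : QuatternGroup F P K → ℂ} (hχ : χ ∈ IrrSupp F P K ↑coreZ) : χ 1 = d := by
  obtain ⟨a, ha⟩ := (mem_irrSupp_iff p hK hS).1 hχ
  simpa using apply_one_of_mem_irrOver p (hd a) ha

variable [Finite F]

include hK hS in
theorem exists_bijOn_irrSupp_of_three_ne_zero (h3 : (3 : F) ≠ 0) :
    ∃ χ : (Fin 6 → Fˣ) → QuatternGroup F P K → ℂ,
      Set.BijOn χ Set.univ (IrrSupp F P K ↑coreZ) ∧ ∀ a, HasCentralLabel p P K a (χ a) := by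
  have hne (a : Fin 6 → Fˣ) (k) : (a k : F) ≠ 0 := (a k).ne_zero
  choose ψ hψ huniq using fun a : Fin 6 → Fˣ => existsUnique_mem_irrOver p
    (coreRadical_eq_bot h3 (hne a)) (card_radGroup_of_three_ne_zero (hne a) h3)
  have hcomp : ∀ a, (ψ a ∘ (coreEquiv hK hS).symm) ∘ coreEquiv hK hS = ψ a := fun a => by
    ext g
    simp
  refine ⟨fun a => ψ a ∘ (coreEquiv hK hS).symm,
    bijOn_irrSupp (π := id) (hK := hK) (hS := hS) (p := p) fun a => ?_,
    fun a => apply_xq_zIdx ((hcomp a).symm ▸ hψ a)⟩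
  simp only [hcomp, Set.preimage_id]
  refine ⟨?_, Set.injOn_singleton _ _, fun χ hχ => ⟨a, rfl, (huniq a χ hχ).symm⟩⟩
  rintro _ rfl
  exact hψ _

theorem bijOn_indChar_labelChar (h3 : (3 : F) = 0) (a : Fin 6 → Fˣ) :
    Set.BijOn (fun b => indChar (labelSubgroup P K a) (labelChar p h3 a b hK hS) ∘
      coreEquiv hK hS) Set.univ (irrOver coc p (coreDual a)) := by
  have hne (k) : (a k : F) ≠ 0 := (a k).ne_zero
  simp only [indChar_labelChar_comp_coreEquiv]
  refine bijOn_indChar_linChar p (coreRadical_le_isoSpace hne h3)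
    (isPolar_self h3 (altForm_isoVec h3 _)) ?_
    (bijective_labelDual hne h3)
  rw [index_ofSubmodule_isoSpace hne]
  exact card_radGroup_of_three_eq_zero hne h3

theorem bijOn_irrSupp_of_three_eq_zero (h3 : (3 : F) = 0) :
    Set.BijOn (fun i : (Fin 6 → Fˣ) × (F × F) =>
        indChar (labelSubgroup P K i.1) (labelChar p h3 i.1 i.2 hK hS))
      Set.univ (IrrSupp F P K ↑coreZ) := by
  refine bijOn_irrSupp (π := Prod.fst) (hK := hK) (hS := hS) (p := p) fun a => ?_
  have ha := bijOn_indChar_labelChar p hK hS h3 a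
  refine ⟨?_, ?_, fun χ hχ => ?_⟩
  · rintro ⟨_, b⟩ rfl
    exact ha.mapsTo (Set.mem_univ b)
  · rintro ⟨_, b⟩ rfl ⟨_, b'⟩ rfl h
    exact congrArg (Prod.mk _) (ha.injOn (Set.mem_univ b) (Set.mem_univ b') h)
  · obtain ⟨b, -, hb⟩ := ha.surjOn hχ
    exact ⟨(a, b), rfl, hb⟩

theorem hasCentralLabel_indChar_labelChar (h3 : (3 : F) = 0) (a : Fin 6 → Fˣ) (b : F × F) :
    HasCentralLabel p P K a (indChar (labelSubgroup P K a) (labelChar p h3 a b hK hS)) :=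
  apply_xq_zIdx ((bijOn_indChar_labelChar p hK hS h3 a).mapsTo (Set.mem_univ b))

end Parametrization

theorem three_eq_zero_iff (p : ℕ) [Fact p.Prime] {R : Type*} [Semiring R] [CharP R p] :
    (3 : R) = 0 ↔ p = 3 := by
  rw [← Nat.cast_ofNat, CharP.cast_eq_zero_iff R p,
    Nat.prime_dvd_prime_iff_eq Fact.out Nat.prime_three]

end UE6

theorem proposition5p1 (p : ℕ) [Fact p.Prime] (F : Type*) [Field F] [Fintype F]
    [Algebra (ZMod p) F] (P K : Set UE6.Lat) (hK : UE6.IsNormalPattern K P)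
    (hS : P \ K = ↑UE6.coreS) :
    ∃ _ : (UE6.XIn F P K).Normal,
      (p ≠ 3 →
        (UE6.IrrSupp F P K ↑UE6.coreZ).ncard = (Fintype.card F - 1) ^ 6 ∧
        (∀ χ ∈ UE6.IrrSupp F P K ↑UE6.coreZ, χ 1 = (Fintype.card F : ℂ) ^ 5) ∧
        ∃ χ : (Fin 6 → Fˣ) → UE6.QuatternGroup F P K → ℂ,
          Set.BijOn χ Set.univ (UE6.IrrSupp F P K ↑UE6.coreZ) ∧
          ∀ a, UE6.HasCentralLabel p P K a (χ a)) ∧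
      (p = 3 →
        (UE6.IrrSupp F P K ↑UE6.coreZ).ncard =
          Fintype.card F ^ 2 * (Fintype.card F - 1) ^ 6 ∧
        (∀ χ ∈ UE6.IrrSupp F P K ↑UE6.coreZ, χ 1 = (Fintype.card F : ℂ) ^ 4) ∧
        ∃ χ : (Fin 6 → Fˣ) × (F × F) → UE6.QuatternGroup F P K → ℂ,
          Set.BijOn χ Set.univ (UE6.IrrSupp F P K ↑UE6.coreZ) ∧
          ∀ a b, UE6.HasCentralLabel p P K a (χ (a, b)) ∧
            ∃ ψ : UE6.labelSubgroup P K a →* ℂˣ,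
              UE6.IsLabelChar p a b ψ ∧ χ (a, b) = UE6.indChar (UE6.labelSubgroup P K a) ψ) := by
  have hN : (UE6.XIn F P K).Normal := UE6.XIn_normal hK
  have : CharP F p := charP_of_injective_algebraMap (algebraMap (ZMod p) F).injective p
  have hunits : Nat.card (Fin 6 → Fˣ) = (Nat.card F - 1) ^ 6 := by
    simp [Nat.card_pi, Nat.card_units]
  rw [← Nat.card_eq_fintype_card]
  refine ⟨hN, fun hp => ?_, fun hp => ?_⟩
  · have h3 : (3 : F) ≠ 0 := mt (UE6.three_eq_zero_iff p).1 hp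
    have hdeg (a : Fin 6 → Fˣ) := UE6.card_radGroup_of_three_ne_zero (fun k => (a k).ne_zero) h3
    obtain ⟨χ, hχ, hlabel⟩ := UE6.exists_bijOn_irrSupp_of_three_ne_zero p hK hS h3
    refine ⟨by rw [← hχ.ncard_eq, Set.ncard_univ, hunits], fun χ hχ => ?_, χ, hχ, hlabel⟩
    exact_mod_cast UE6.apply_one_of_mem_irrSupp p hK hS hdeg hχ
  · have h3 : (3 : F) = 0 := (UE6.three_eq_zero_iff p).2 hp
    have hdeg (a : Fin 6 → Fˣ) := UE6.card_radGroup_of_three_eq_zero (fun k => (a k).ne_zero) h3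
    have hbij := UE6.bijOn_irrSupp_of_three_eq_zero p hK hS h3
    refine ⟨?_, fun χ hχ => ?_, _, hbij, fun a b =>
      ⟨UE6.hasCentralLabel_indChar_labelChar p hK hS h3 a b, _,
        UE6.isLabelChar_labelChar h3 b hK hS, rfl⟩⟩
    · rw [← hbij.ncard_eq, Set.ncard_univ, Nat.card_prod, hunits, Nat.card_prod]
      ring
    · exact_mod_cast UE6.apply_one_of_mem_irrSupp p hK hS hdeg hχ
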